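/- Call $(d_1,d_2,d_3)$ an admissible triple if the $d_i\neq 1$ are pairwise distinct squarefree integers (of either sign) with $d_3=d_1d_2/\gcd(d_1,d_2)^2$. Let $\mathbf 1_{D_4}(d_1,d_2,d_3)=1$ if the biquadratic field $\mathbb Q(\sqrt{d_1},\sqrt{d_2},\sqrt{d_3})$ is contained in a finite Galois extension of $\mathbb Q$ whose Galois group is isomorphic to the dihedral group $D_4$ of order $8$, and $\mathbf 1_{D_4}(d_1,d_2,d_3)=0$ otherwise. Notation. $(\frac{\cdot}{\cdot})$ is the Kronecker symbol. For odd integers put $\eta(a,b)=(-1)^{\frac{a-1}{2}\frac{b-1}{2}}$ and $\Phi(a,b,c)=\eta(a,b+2)\,\eta(b,c+2)\,\eta(c,a+2)$. For a positive integer $n$ put $\psi(n)=1$ if every prime divisor of $n$ is $\equiv 1 \pmod 4$, and $\psi(n)=0$ otherwise; $\omega(n)$ is the number of distinct prime divisors of $n$. Let $\varepsilon_i=\operatorname{sign}(d_i)\in\{\pm1\}$ for $i=1,2$. For positive integers $D_1,D_2,D_3$, $\sum_{D_i=D_{i1}D_{i2}}$ is the sum over all factorizations $D_i=D_{i1}D_{i2}$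 $(i=1,2,3)$ into positive integers; for $\vec D=(D_{11},D_{12},D_{21},D_{22},D_{31},D_{32})$ put $\omega(\vec D)=\omega(D_{11}D_{12}D_{21}D_{22}D_{31}D_{32})$ and $$g(\vec D)=\Big(\frac{D_{22}D_{32}}{D_{11}}\Big)\Big(\frac{D_{12}D_{32}}{D_{21}}\Big)\Big(\frac{D_{12}D_{22}}{D_{31}}\Big).$$ Write $\mathbf 1_{P}$ for $1$ if $P$ holds and $0$ otherwise, and put $$\begin{aligned}R(\vec D)=&-\mathbf 1_{(\varepsilon_1,\varepsilon_2)\notin\{(1,-1),(-1,1)\}}\,\psi(D_1D_2)-\mathbf 1_{(\varepsilon_1,\varepsilon_2)\notin\{(1,-1),(-1,-1)\}}\,\psi(D_2D_3)\\&-\mathbf 1_{(\varepsilon_1,\varepsilon_2)\notin\{(-1,1),(-1,-1)\}}\,\psi(D_1D_3)+\mathbf 1_{(\varepsilon_1,\varepsilon_2)=(1,1)}\,\psi(D_1D_2D_3).\end{aligned}$$ Let $(d_1,d_2,d_3)$ be an admissible triple. (Odd case.) If $2\nmid d_1d_2$, put $D_3=\gcd(d_1,d_2)>0$, $D_1=d_1/(\varepsilon_1D_3)$,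 $D_2=d_2/(\varepsilon_2D_3)$. Then $D_1D_2D_3$ is an odd, positive, squarefree integer, $(d_1,d_2,d_3)=(\varepsilon_1D_1D_3,\ \varepsilon_2D_2D_3,\ \varepsilon_1\varepsilon_2D_1D_2)$, and $$\mathbf 1_{D_4}(d_1,d_2,d_3)=\mathbf 1_{D_4}(\varepsilon_1D_1D_3,\varepsilon_2D_2D_3,\varepsilon_1\varepsilon_2D_1D_2)=\sum_{D_i=D_{i1}D_{i2}}F_{\rm odd}(\vec D)\,2^{-\omega(\vec D)}g(\vec D),$$ where $$\begin{aligned}F_{\rm odd}(\vec D)=\Big\{&\mathbf 1_{(\varepsilon_1,\varepsilon_2)\ne(1,-1)}\tfrac12\big(1+\eta(\varepsilon_1D_1D_3+2,\varepsilon_2D_2D_3)\big)\Big(\frac{-1}{D_{11}D_{31}}\Big)\\&+\mathbf 1_{(\varepsilon_1,\varepsilon_2)\ne(-1,1)}\tfrac12\big(1+\eta(\varepsilon_1D_1D_3,\varepsilon_2D_2D_3+2)\big)\Big(\frac{-1}{D_{21}D_{31}}\Big)\\&+\mathbf 1_{(\varepsilon_1,\varepsilon_2)\ne(-1,-1)}\tfrac12\big(1+\eta(\varepsilon_1D_1D_3,\varepsilon_2D_2D_3)\big)\Big(\frac{-1}{D_{11}D_{21}}\Big)\Big\}\\&\times\Big(\frac{\varepsilon_1}{D_{21}D_{31}}\Big)\Big(\frac{\varepsilon_2}{D_{11}D_{31}}\Big)\Phi(D_{11},D_{21},D_{31})+R(\vec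 D).\end{aligned}$$ (Even case.) If $2\mid\gcd(d_1,d_2)$, put $D_3=\gcd(d_1,d_2)/2>0$, $D_1=d_1/(2\varepsilon_1D_3)$, $D_2=d_2/(2\varepsilon_2D_3)$. Then $D_1D_2D_3$ is an odd, positive, squarefree integer, $(d_1,d_2,d_3)=(2\varepsilon_1D_1D_3,\ 2\varepsilon_2D_2D_3,\ \varepsilon_1\varepsilon_2D_1D_2)$, and $$\mathbf 1_{D_4}(d_1,d_2,d_3)=\mathbf 1_{D_4}(2\varepsilon_1D_1D_3,2\varepsilon_2D_2D_3,\varepsilon_1\varepsilon_2D_1D_2)=\sum_{D_i=D_{i1}D_{i2}}F_{\rm even}(\vec D)\,2^{-\omega(\vec D)}g(\vec D),$$ where $$\begin{aligned}F_{\rm even}(\vec D)=\Big\{&\mathbf 1_{(\varepsilon_1,\varepsilon_2)\ne(1,-1)}\tfrac12\Big(1+\eta(\varepsilon_1D_1D_3+2,\varepsilon_2D_2D_3)\Big(\frac{2}{D_1D_2}\Big)\Big)\Big(\frac{-1}{D_{11}D_{31}}\Big)\\&+\mathbf 1_{(\varepsilon_1,\varepsilon_2)\ne(-1,1)}\tfrac12\Big(1+\eta(\varepsilon_1D_1D_3,\varepsilon_2D_2D_3+2)\Big(\frac{2}{D_1D_2}\Big)\Big)\Big(\frac{-1}{D_{21}D_{31}}\Big)\\&+\mathbf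 1_{(\varepsilon_1,\varepsilon_2)\ne(-1,-1)}\tfrac12\Big(1+\eta(\varepsilon_1D_1D_3,\varepsilon_2D_2D_3)\Big(\frac{2}{D_1D_2}\Big)\Big)\Big(\frac{-1}{D_{11}D_{21}}\Big)\Big\}\\&\times\Big(\frac{\varepsilon_1}{D_{21}D_{31}}\Big)\Big(\frac{\varepsilon_2}{D_{11}D_{31}}\Big)\Big(\frac{2}{D_{11}D_{21}}\Big)\Phi(D_{11},D_{21},D_{31})\\&+R(\vec D)\Big(\frac{2}{D_{11}D_{21}}\Big)\cdot\tfrac12\Big(1+\Big(\frac{2}{D_1D_2}\Big)\Big).\end{aligned}$$ -/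

import Mathlib

/-- An admissible triple: pairwise distinct squarefree integers, none equal to `1`, with
`d₃ = d₁ d₂ / gcd(d₁, d₂)²` (the division is exact). -/
structure AdmissibleTriple (d₁ d₂ d₃ : ℤ) : Prop where
  squarefree₁ : Squarefree d₁
  squarefree₂ : Squarefree d₂
  squarefree₃ : Squarefree d₃
  ne_one₁ : d₁ ≠ 1
  ne_one₂ : d₂ ≠ 1
  ne_one₃ : d₃ ≠ 1
  ne₁₂ : d₁ ≠ d₂
  ne₁₃ : d₁ ≠ d₃
  ne₂₃ : d₂ ≠ d₃
  eq₃ : d₃ = d₁ * d₂ / (Int.gcd d₁ d₂ : ℤ) ^ 2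

/-- The field `ℚ(√d₁, √d₂, √d₃)` inside a fixed algebraic closure of `ℚ`. -/
noncomputable def sqrtField (d₁ d₂ d₃ : ℤ) : IntermediateField ℚ (AlgebraicClosure ℚ) :=
  IntermediateField.adjoin ℚ
    {x : AlgebraicClosure ℚ | x ^ 2 = (d₁ : AlgebraicClosure ℚ) ∨
      x ^ 2 = (d₂ : AlgebraicClosure ℚ) ∨ x ^ 2 = (d₃ : AlgebraicClosure ℚ)}

/-- `K` admits a `G`-extension: some finite Galois extension of `ℚ` with Galois group
isomorphic to `G` contains `K`. -/
def AdmitsExtension (G : Type) [Group G]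
    (K : IntermediateField ℚ (AlgebraicClosure ℚ)) : Prop :=
  ∃ F : IntermediateField ℚ (AlgebraicClosure ℚ),
    K ≤ F ∧ FiniteDimensional ℚ F ∧ IsGalois ℚ F ∧ Nonempty ((F ≃ₐ[ℚ] F) ≃* G)

open Classical in
/-- The indicator `1_{D₄}(d₁, d₂, d₃)`; `DihedralGroup 4` is the dihedral group of order `8`. -/
noncomputable def indicatorD4 (d₁ d₂ d₃ : ℤ) : ℚ :=
  if AdmitsExtension (DihedralGroup 4) (sqrtField d₁ d₂ d₃) then 1 else 0

/-- `η(a, b) = (-1)^((a-1)/2 · (b-1)/2)`, used for odd integers `a`, `b` of either sign. -/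
def eta (a b : ℤ) : ℤ := (((-1 : ℤˣ) ^ ((a - 1) / 2 * ((b - 1) / 2)) : ℤˣ) : ℤ)

/-- `Φ(a, b, c) = η(a, b+2) η(b, c+2) η(c, a+2)`. -/
def bigPhi (a b c : ℤ) : ℤ := eta a (b + 2) * eta b (c + 2) * eta c (a + 2)

/-- `ψ(n) = 1` if every prime divisor of `n` is `≡ 1 mod 4`, and `ψ(n) = 0` otherwise. -/
def psiOneModFour (n : ℕ) : ℚ := if ∀ p ∈ n.primeFactors, p % 4 = 1 then 1 else 0

/-- Six natural numbers `D_{ij}`, `1 ≤ i ≤ 3`, `1 ≤ j ≤ 2`. -/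
structure DTuple where
  D11 : ℕ
  D12 : ℕ
  D21 : ℕ
  D22 : ℕ
  D31 : ℕ
  D32 : ℕ

namespace DTuple

/-- `D₁ = D₁₁ D₁₂`. -/
def D1 (D : DTuple) : ℕ := D.D11 * D.D12

/-- `D₂ = D₂₁ D₂₂`. -/
def D2 (D : DTuple) : ℕ := D.D21 * D.D22

/-- `D₃ = D₃₁ D₃₂`. -/
def D3 (D : DTuple) : ℕ := D.D31 * D.D32

/-- The number of distinct prime divisors of the product of the six entries. -/
def omega (D : DTuple) : ℕ :=
  ArithmeticFunction.cardDistinctFactors (D.D11 * D.D12 * D.D21 * D.D22 * D.D31 * D.D32)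

/-- `g(D) = (D₂₂D₃₂ / D₁₁) (D₁₂D₃₂ / D₂₁) (D₁₂D₂₂ / D₃₁)`. -/
def g (D : DTuple) : ℤ :=
  jacobiSym (D.D22 * D.D32 : ℕ) D.D11 * jacobiSym (D.D12 * D.D32 : ℕ) D.D21 *
    jacobiSym (D.D12 * D.D22 : ℕ) D.D31

/-- The combination of `ψ`-terms common to both weights. -/
def psiTerms (ε₁ ε₂ : ℤ) (D : DTuple) : ℚ :=
  - (if (ε₁, ε₂) ≠ (1, -1) ∧ (ε₁, ε₂) ≠ (-1, 1) then 1 else 0) * psiOneModFour (D.D1 * D.D2)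
  - (if (ε₁, ε₂) ≠ (1, -1) ∧ (ε₁, ε₂) ≠ (-1, -1) then 1 else 0) * psiOneModFour (D.D2 * D.D3)
  - (if (ε₁, ε₂) ≠ (-1, 1) ∧ (ε₁, ε₂) ≠ (-1, -1) then 1 else 0) * psiOneModFour (D.D1 * D.D3)
  + (if (ε₁, ε₂) = (1, 1) then 1 else 0) * psiOneModFour (D.D1 * D.D2 * D.D3)

/-- The weight `F_odd(D; D₄)` for the signs `ε₁, ε₂`. -/
def FOdd (ε₁ ε₂ : ℤ) (D : DTuple) : ℚ :=
  ((if (ε₁, ε₂) ≠ (1, -1) then 1 else 0)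
        * (1 / 2 * (1 + eta (ε₁ * D.D1 * D.D3 + 2) (ε₂ * D.D2 * D.D3)))
        * jacobiSym (-1) (D.D11 * D.D31)
    + (if (ε₁, ε₂) ≠ (-1, 1) then 1 else 0)
        * (1 / 2 * (1 + eta (ε₁ * D.D1 * D.D3) (ε₂ * D.D2 * D.D3 + 2)))
        * jacobiSym (-1) (D.D21 * D.D31)
    + (if (ε₁, ε₂) ≠ (-1, -1) then 1 else 0)
        * (1 / 2 * (1 + eta (ε₁ * D.D1 * D.D3) (ε₂ * D.D2 * D.D3)))
        * jacobiSym (-1) (D.D11 * D.D21))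
      * jacobiSym ε₁ (D.D21 * D.D31) * jacobiSym ε₂ (D.D11 * D.D31)
      * bigPhi D.D11 D.D21 D.D31
  + D.psiTerms ε₁ ε₂

/-- The weight `F_even(D; D₄)` for the signs `ε₁, ε₂`. -/
def FEven (ε₁ ε₂ : ℤ) (D : DTuple) : ℚ :=
  ((if (ε₁, ε₂) ≠ (1, -1) then 1 else 0)
        * (1 / 2 * (1 + eta (ε₁ * D.D1 * D.D3 + 2) (ε₂ * D.D2 * D.D3)
            * jacobiSym 2 (D.D1 * D.D2)))
        * jacobiSym (-1) (D.D11 * D.D31)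
    + (if (ε₁, ε₂) ≠ (-1, 1) then 1 else 0)
        * (1 / 2 * (1 + eta (ε₁ * D.D1 * D.D3) (ε₂ * D.D2 * D.D3 + 2)
            * jacobiSym 2 (D.D1 * D.D2)))
        * jacobiSym (-1) (D.D21 * D.D31)
    + (if (ε₁, ε₂) ≠ (-1, -1) then 1 else 0)
        * (1 / 2 * (1 + eta (ε₁ * D.D1 * D.D3) (ε₂ * D.D2 * D.D3)
            * jacobiSym 2 (D.D1 * D.D2)))
        * jacobiSym (-1) (D.D11 * D.D21))
      * jacobiSym ε₁ (D.D21 * D.D31) * jacobiSym ε₂ (D.D11 * D.D31)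
      * jacobiSym 2 (D.D11 * D.D21) * bigPhi D.D11 D.D21 D.D31
  + D.psiTerms ε₁ ε₂ * jacobiSym 2 (D.D11 * D.D21)
      * (1 / 2 * (1 + jacobiSym 2 (D.D1 * D.D2)))

end DTuple

/-- `∑ F(D) 2^{-ω(D)} g(D)` over all factorizations `Dᵢ = D_{i1} D_{i2}`, `i = 1, 2, 3`. -/
def divisorSum (D₁ D₂ D₃ : ℕ) (F : DTuple → ℚ) : ℚ :=
  ∑ p ∈ D₁.divisorsAntidiagonal, ∑ q ∈ D₂.divisorsAntidiagonal, ∑ r ∈ D₃.divisorsAntidiagonal,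
    F ⟨p.1, p.2, q.1, q.2, r.1, r.2⟩
      * (1 / 2 ^ DTuple.omega ⟨p.1, p.2, q.1, q.2, r.1, r.2⟩)
      * DTuple.g ⟨p.1, p.2, q.1, q.2, r.1, r.2⟩

/-! The biquadratic field lies in a `D₄`-extension exactly when one of the conics `u x² + v y² = z²`
is solvable, with `u`, `v` two of the three `dᵢ`. If `z² = d₁ x² + d₂ y²`, then `z + x √d₁` has norm
`d₂ y²` from `ℚ(√d₁)`, and adjoining its square root and `√d₂` gives a dihedral extension.
Conversely, a `θ` fixed by a reflection and negated by the central rotation yields such a conic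
(`conic_of_dihedral`). Since `d₃` is `d₁ d₂` up to squares, the three conics are those of `(d₁,
d₂)`, `(-d₁, d₂)` and `(d₁, -d₂)` (`admitsExtension_iff`). Rescaling by `k D₃`, with `k = 1` in the
odd case and `k = 2` in the even case, turns them into `e₁ D₁ x² + e₂ D₂ y² = k D₃ z²`.

By Legendre's theorem such a conic is solvable if and only if the signs allow it and one residue
condition holds at each prime of `D₁ D₂ D₃` (`isotropic_iff`). For squarefree `n` coprime to `m`,
the condition that `m` is a residue modulo every prime of `n` is the average of `(m/d)` over `d ∣
n`. Each solvability indicator is thus a sum over factorizations `Dᵢ = Dᵢ₁ Dᵢ₂` with weight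
`2^{-ω}`, and quadratic reciprocity turns the product of characters into `g` times `η`-factors and
signs (`jacobiSym_product_eq`). The factors `½ (1 + η ⋯)` are indicators of the 2-adic condition,
which solvability implies (`eta_of_isotropic`), so inserting them changes nothing.

The indicator of "at least one conic is solvable" follows by inclusion-exclusion. Two of the conics
together demand that both `m` and `-m` be residues modulo the primes of two of the `Dᵢ`, so these
primes are all `1` mod `4`. This produces the `ψ`-terms (`isotropic_pair₁₂`, `isotropic_pair₂₃`,
`isotropic_pair₁₃`), and `divisorSum_weight` assembles everything. -/

/-! ### Legendre's theorem and local solubility of ternary forms -/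

/-- The diagonal ternary form `a x² + b y² + c z²` has a nontrivial integral zero. -/
def TernaryIsotropic (a b c : ℤ) : Prop :=
  ∃ x y z : ℤ, (x ≠ 0 ∨ y ≠ 0 ∨ z ≠ 0) ∧ a * x ^ 2 + b * y ^ 2 + c * z ^ 2 = 0

namespace TernaryIsotropic

theorem rotate {a b c : ℤ} (h : TernaryIsotropic a b c) : TernaryIsotropic b c a := by
  obtain ⟨x, y, z, hne, h⟩ := h
  exact ⟨y, z, x, by tauto, by linarith⟩

theorem swap {a b c : ℤ} (h : TernaryIsotropic a b c) : TernaryIsotropic b a c := by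
  obtain ⟨x, y, z, hne, h⟩ := h
  exact ⟨y, x, z, by tauto, by linarith⟩

theorem neg {a b c : ℤ} (h : TernaryIsotropic a b c) : TernaryIsotropic (-a) (-b) (-c) := by
  obtain ⟨x, y, z, hne, h⟩ := h
  exact ⟨x, y, z, hne, by linarith⟩

end TernaryIsotropic

/-- Over a field, a diagonal binary form of square negated determinant vanishes on a line. -/
theorem exists_linear_form_of_isSquare {K : Type*} [Field K] {B C : K} (hB : B ≠ 0)
    (h : IsSquare (-(B * C))) :
    ∃ m n : K, ∀ y z : K, m * y + n * z = 0 → B * y ^ 2 + C * z ^ 2 = 0 := by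
  obtain ⟨k, hk⟩ := h
  -- `B (B y² + C z²) = (B y + k z)(B y - k z)`, so the zero set contains the line `B y + k z = 0`.
  refine ⟨B, k, fun y z hyz => ?_⟩
  have : B * (B * y ^ 2 + C * z ^ 2) = 0 := by
    linear_combination (B * y - k * z) * hyz - z ^ 2 * hk
  exact (mul_eq_zero.mp this).resolve_left hB

/-- The initial segment `{y < m}` with `y ² < n` for all its members and `n ≤ m ²`. -/
theorem Nat.exists_sq_lt_of_lt {n : ℕ} : ∃ m : ℕ, n ≤ m ^ 2 ∧ ∀ y < m, y ^ 2 < n := by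
  classical
  have hex : ∃ m : ℕ, n ≤ m ^ 2 := ⟨n, by nlinarith [Nat.le_self_pow two_ne_zero n]⟩
  exact ⟨Nat.find hex, Nat.find_spec hex, fun y hy => not_le.mp (Nat.find_min hex hy)⟩

/-- Pigeonhole principle for a system of linear congruences, one for each prime divisor of a
squarefree integer. -/
theorem exists_small_zero_of_linear_forms {N X Y Z : ℕ} (hN : Squarefree N) (hlt : N < X * Y * Z)
    (l m n : ∀ p : ℕ, ZMod p) :
    ∃ x y z : ℤ, (x ≠ 0 ∨ y ≠ 0 ∨ z ≠ 0) ∧ x.natAbs < X ∧ y.natAbs < Y ∧ z.natAbs < Z ∧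
      ∀ p ∈ N.primeFactors, l p * x + m p * y + n p * z = 0 := by
  classical
  let f : Fin X × Fin Y × Fin Z → ∀ p : N.primeFactors, ZMod p := fun v p =>
    l p * (v.1 : ℕ) + m p * (v.2.1 : ℕ) + n p * (v.2.2 : ℕ)
  have : ∀ p : N.primeFactors, NeZero (p : ℕ) := fun p =>
    ⟨(Nat.prime_of_mem_primeFactors p.2).ne_zero⟩
  -- As `N` is squarefree, there are `∏ p = N` vectors of residues, fewer than the points of the
  -- box.
  have hcard : Fintype.card (∀ p : N.primeFactors, ZMod p) < Fintype.card (Fin X × Fin Y × Fin Z) := by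
    rw [Fintype.card_pi]
    simp only [ZMod.card, Fintype.card_prod, Fintype.card_fin]
    rw [Finset.prod_coe_sort N.primeFactors (fun p => p), Nat.prod_primeFactors_of_squarefree hN,
      ← mul_assoc]
    exact hlt
  obtain ⟨u, v, huv, hf⟩ := Fintype.exists_ne_map_eq_of_card_lt f hcard
  refine ⟨(u.1 : ℕ) - (v.1 : ℕ), (u.2.1 : ℕ) - (v.2.1 : ℕ), (u.2.2 : ℕ) - (v.2.2 : ℕ),
    ?_, ?_, ?_, ?_, fun p hp => ?_⟩
  · by_contra hcon
    push Not at hcon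
    refine huv (Prod.ext (Fin.ext ?_) (Prod.ext (Fin.ext ?_) (Fin.ext ?_))) <;> omega
  · have := u.1.2; have := v.1.2; omega
  · have := u.2.1.2; have := v.2.1.2; omega
  · have := u.2.2.2; have := v.2.2.2; omega
  · have := congrFun hf ⟨p, hp⟩
    simp only [f] at this
    push_cast
    linear_combination this

/-- **Legendre's theorem** on diagonal ternary forms, existence part. -/
theorem legendre_ternary {a b c : ℕ} (hsq : Squarefree (a * b * c))
    (ha : ∀ p : ℕ, p.Prime → p ∣ a → IsSquare ((b : ZMod p) * c))
    (hb : ∀ p : ℕ, p.Prime → p ∣ b → IsSquare ((a : ZMod p) * c))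
    (hc : ∀ p : ℕ, p.Prime → p ∣ c → IsSquare (-((a : ZMod p) * b))) :
    TernaryIsotropic a b (-c) := by
  have hN0 : a * b * c ≠ 0 := hsq.ne_zero
  have ha0 : 0 < a := Nat.pos_of_ne_zero (by rintro rfl; simp at hN0)
  have hb0 : 0 < b := Nat.pos_of_ne_zero (by rintro rfl; simp at hN0)
  have hc0 : 0 < c := Nat.pos_of_ne_zero (by rintro rfl; simp at hN0)
  -- At a prime dividing one coefficient the form becomes binary and vanishes on a line, by the
  -- square condition. A single linear congruence modulo `p` therefore makes the whole form
  -- divisible by `p`.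
  have key : ∀ p : ℕ, ∃ l m n : ZMod p, p ∈ (a * b * c).primeFactors →
      ∀ x y z : ZMod p, l * x + m * y + n * z = 0 → a * x ^ 2 + b * y ^ 2 - c * z ^ 2 = 0 := by
    intro p
    by_cases hp : p ∈ (a * b * c).primeFactors
    swap
    · exact ⟨0, 0, 0, fun h => absurd h hp⟩
    have hpp := Nat.prime_of_mem_primeFactors hp
    have : Fact p.Prime := ⟨hpp⟩
    have hnd : ¬ p * p ∣ a * b * c := fun h => hpp.one_lt.ne' (Nat.isUnit_iff.mp (hsq p h))
    have hne : ∀ {u v w : ℕ}, a * b * c = u * v * w → p ∣ u → (v : ZMod p) ≠ 0 := by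
      intro u v w h hu hv
      rw [ZMod.natCast_eq_zero_iff] at hv
      exact hnd (h ▸ Dvd.dvd.mul_right (mul_dvd_mul hu hv) w)
    rcases (hpp.dvd_mul.mp (Nat.dvd_of_mem_primeFactors hp)) with hab | hpc
    · rcases hpp.dvd_mul.mp hab with hpa | hpb
      · obtain ⟨m, n, hmn⟩ := exists_linear_form_of_isSquare (hne rfl hpa)
          (C := -(c : ZMod p)) (by simpa using ha p hpp hpa)
        refine ⟨0, m, n, fun _ x y z h => ?_⟩
        have h0 : (a : ZMod p) = 0 := (ZMod.natCast_eq_zero_iff _ _).mpr hpa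
        linear_combination hmn y z (by linear_combination h) + x ^ 2 * h0
      · obtain ⟨m, n, hmn⟩ := exists_linear_form_of_isSquare
          (hne (u := b) (v := a) (w := c) (by ring) hpb)
          (C := -(c : ZMod p)) (by simpa using hb p hpp hpb)
        refine ⟨m, 0, n, fun _ x y z h => ?_⟩
        have h0 : (b : ZMod p) = 0 := (ZMod.natCast_eq_zero_iff _ _).mpr hpb
        linear_combination hmn x z (by linear_combination h) + y ^ 2 * h0
    · obtain ⟨m, n, hmn⟩ := exists_linear_form_of_isSquare
        (hne (u := c) (v := a) (w := b) (by ring) hpc) (hc p hpp hpc)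
      refine ⟨m, n, 0, fun _ x y z h => ?_⟩
      have h0 : (c : ZMod p) = 0 := (ZMod.natCast_eq_zero_iff _ _).mpr hpc
      linear_combination hmn x y (by linear_combination h) - z ^ 2 * h0
  choose l m n hlmn using key
  obtain ⟨Y, hY, hY'⟩ := Nat.exists_sq_lt_of_lt (n := c * a)
  obtain ⟨Z, hZ, hZ'⟩ := Nat.exists_sq_lt_of_lt (n := a * b)
  -- The bound for `x` is taken strictly above `√(bc)`, to make the box strictly larger than `abc`.
  -- The bounds for `y` and `z` are rounded-up roots, so that `y² < ca` and `z² < ab` stay strict.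
  have hX : b * c < (Nat.sqrt (b * c) + 1) ^ 2 := by
    have := Nat.lt_succ_sqrt (b * c); rw [sq]; exact this
  have hlt : a * b * c < (Nat.sqrt (b * c) + 1) * Y * Z := by
    refine lt_of_pow_lt_pow_left₀ 2 (Nat.zero_le _) ?_
    calc (a * b * c) ^ 2 = b * c * (c * a * (a * b)) := by ring
      _ < (Nat.sqrt (b * c) + 1) ^ 2 * (c * a * (a * b)) :=
          Nat.mul_lt_mul_of_pos_right hX (by positivity)
      _ ≤ (Nat.sqrt (b * c) + 1) ^ 2 * (Y ^ 2 * Z ^ 2) := by gcongr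
      _ = _ := by ring
  obtain ⟨x, y, z, hne, hx, hy, hz, hL⟩ := exists_small_zero_of_linear_forms hsq hlt l m n
  have hx2 : x ^ 2 ≤ (b * c : ℤ) := by
    have : x.natAbs ^ 2 ≤ b * c :=
      (Nat.pow_le_pow_left (Nat.lt_succ_iff.mp hx) 2).trans (Nat.sqrt_le' _)
    rw [← Int.natAbs_sq]; exact_mod_cast this
  have hy2 : y ^ 2 < (c * a : ℤ) := by
    rw [← Int.natAbs_sq]; exact_mod_cast hY' _ hy
  have hz2 : z ^ 2 < (a * b : ℤ) := by
    rw [← Int.natAbs_sq]; exact_mod_cast hZ' _ hz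
  have hdvd : ((a * b * c : ℕ) : ℤ) ∣ a * x ^ 2 + b * y ^ 2 - c * z ^ 2 := by
    rw [Int.natCast_dvd, ← Nat.prod_primeFactors_of_squarefree hsq]
    refine Finset.prod_primes_dvd _ (fun p hp => (Nat.prime_of_mem_primeFactors hp).prime)
      fun p hp => ?_
    rw [← Int.natCast_dvd, ← ZMod.intCast_zmod_eq_zero_iff_dvd]
    have := hlmn p hp x y z (hL p hp)
    push_cast
    exact this
  obtain ⟨k, hk⟩ := hdvd
  push_cast at hk
  have hA : (0 : ℤ) < a := by exact_mod_cast ha0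
  have hB : (0 : ℤ) < b := by exact_mod_cast hb0
  have hC : (0 : ℤ) < c := by exact_mod_cast hc0
  have hN : (0 : ℤ) < a * b * c := by positivity
  have h1 := mul_le_mul_of_nonneg_left hx2 hA.le
  have h2 := mul_lt_mul_of_pos_left hy2 hB
  have h3 := mul_lt_mul_of_pos_left hz2 hC
  have h4 := mul_nonneg hA.le (sq_nonneg x)
  have h5 := mul_nonneg hB.le (sq_nonneg y)
  have h6 := mul_nonneg hC.le (sq_nonneg z)
  -- The size bounds give `-abc < a x² + b y² - c z² < 2abc`, and the value is `k · abc`.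
  have hk1 : -1 < k := by
    by_contra hcon
    have : k ≤ -1 := by omega
    nlinarith [mul_le_mul_of_nonneg_left this hN.le]
  have hk2 : k < 2 := by
    by_contra hcon
    have : 2 ≤ k := by omega
    nlinarith [mul_le_mul_of_nonneg_left this hN.le]
  obtain rfl | rfl : k = 0 ∨ k = 1 := by omega
  · exact ⟨x, y, z, hne, by linear_combination hk⟩
  -- When the value is `abc`, so that `a x² + b y² = c (z² + ab)`, the identity `a (xz + by)² + b
  -- (yz - ax)² = (z² + ab)(a x² + b y²)` gives a zero. Its last coordinate is positive.
  · refine ⟨x * z + b * y, y * z - a * x, z ^ 2 + a * b, Or.inr (Or.inr ?_), ?_⟩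
    · positivity
    · linear_combination (z ^ 2 + a * b : ℤ) * hk

/-- A nontrivial zero can be chosen with coordinates not all divisible by a given prime. -/
theorem TernaryIsotropic.exists_not_dvd {a b c : ℤ} (h : TernaryIsotropic a b c) {p : ℤ}
    (hp : Prime p) :
    ∃ x y z : ℤ, ¬ (p ∣ x ∧ p ∣ y ∧ p ∣ z) ∧ a * x ^ 2 + b * y ^ 2 + c * z ^ 2 = 0 := by
  obtain ⟨x, y, z, hne, h⟩ := h
  induction hn : x.natAbs + y.natAbs + z.natAbs using Nat.strong_induction_on generalizing x y z with
  | _ n ih =>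
    by_cases hd : p ∣ x ∧ p ∣ y ∧ p ∣ z
    swap
    · exact ⟨x, y, z, hd, h⟩
    obtain ⟨⟨x, rfl⟩, ⟨y, rfl⟩, ⟨z, rfl⟩⟩ := hd
    have hp0 : p ≠ 0 := hp.ne_zero
    have hp2 : 2 ≤ p.natAbs := (Int.prime_iff_natAbs_prime.mp hp).two_le
    have hne' : x ≠ 0 ∨ y ≠ 0 ∨ z ≠ 0 := by
      simpa [hp0] using hne
    -- Descent: dividing a zero by `p` strictly decreases the sum of the absolute values.
    refine ih (x.natAbs + y.natAbs + z.natAbs) ?_ x y z hne' ?_ rfl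
    · have : 0 < x.natAbs + y.natAbs + z.natAbs := by omega
      rw [← hn]
      simp only [Int.natAbs_mul]
      nlinarith
    · have : p ^ 2 * (a * x ^ 2 + b * y ^ 2 + c * z ^ 2) = 0 := by linear_combination h
      exact (mul_eq_zero.mp this).resolve_left (pow_ne_zero 2 hp0)

/-- Local condition at a prime dividing exactly one coefficient exactly once. -/
theorem TernaryIsotropic.isSquare {a b c : ℤ} (h : TernaryIsotropic a b c) {p : ℕ}
    (hp : p.Prime) (ha : (p : ℤ) ∣ a) (ha2 : ¬ (p : ℤ) ^ 2 ∣ a) (hc : ¬ (p : ℤ) ∣ c) :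
    IsSquare (-((b : ZMod p) * c)) := by
  have hpp : Prime (p : ℤ) := Nat.prime_iff_prime_int.mp hp
  have : Fact p.Prime := ⟨hp⟩
  obtain ⟨x, y, z, hnd, h⟩ := h.exists_not_dvd hpp
  have hc' : (c : ZMod p) ≠ 0 := fun h0 => hc ((ZMod.intCast_zmod_eq_zero_iff_dvd _ _).mp h0)
  have ha' : (a : ZMod p) = 0 := (ZMod.intCast_zmod_eq_zero_iff_dvd _ _).mpr ha
  have hz : (b : ZMod p) * y ^ 2 + c * z ^ 2 = 0 := by
    have := congrArg (Int.cast : ℤ → ZMod p) h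
    push_cast at this
    rw [ha'] at this
    linear_combination this
  -- If `p` divided `y`, it would divide `z`, and then `p²` would divide `a x²`. Since `p² ∤ a`,
  -- also `p ∣ x`, against primitivity.
  have hy : (y : ZMod p) ≠ 0 := by
    intro hy
    rw [hy] at hz
    have hz0 : (z : ZMod p) = 0 := by
      have : (c : ZMod p) * z ^ 2 = 0 := by linear_combination hz
      simpa [hc'] using this
    rw [ZMod.intCast_zmod_eq_zero_iff_dvd] at hy hz0
    obtain ⟨y, rfl⟩ := hy
    obtain ⟨z, rfl⟩ := hz0
    have hx : (p : ℤ) ∣ x := by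
      by_contra hx
      have hcop : IsCoprime ((p : ℤ) ^ 2) (x ^ 2) :=
        ((Prime.coprime_iff_not_dvd hpp).mpr hx).pow
      exact ha2 (hcop.dvd_of_dvd_mul_right ⟨-(b * y ^ 2 + c * z ^ 2), by linear_combination h⟩)
    exact hnd ⟨hx, ⟨y, rfl⟩, ⟨z, rfl⟩⟩
  -- From `b y² = -c z²` one gets `-bc = (c z / y)²`.
  refine ⟨c * z / y, ?_⟩
  field_simp
  linear_combination -hz

/-! ### Residue conditions and the local-global criterion -/

theorem jacobiSym_prime_eq_one_iff {p : ℕ} (hp : p.Prime) {m : ℤ} (hm : ¬ (p : ℤ) ∣ m) :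
    jacobiSym m p = 1 ↔ IsSquare (m : ZMod p) := by
  have : Fact p.Prime := ⟨hp⟩
  rw [← jacobiSym.legendreSym.to_jacobiSym]
  exact legendreSym.eq_one_iff p (fun h => hm ((ZMod.intCast_zmod_eq_zero_iff_dvd _ _).mp h))

/-- `m` is a quadratic residue modulo every prime divisor of `n`. -/
def ResidueModPrimes (m : ℤ) (n : ℕ) : Prop :=
  ∀ p ∈ n.primeFactors, jacobiSym m p = 1

/-- Squarefree odd data `D₁, D₂, D₃` together with an auxiliary factor `k ∈ {1, 2}`. -/
structure OddSquarefreeData (k D₁ D₂ D₃ : ℕ) : Prop where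
  factor : k = 1 ∨ k = 2
  odd : Odd (D₁ * D₂ * D₃)
  squarefree : Squarefree (D₁ * D₂ * D₃)

namespace OddSquarefreeData

variable {k D₁ D₂ D₃ : ℕ}

/-- Together with `swap` this generates all permutations of the three numbers, so arithmetic facts
need only be proved for `D₁` or for the pair `D₁`, `D₂`. -/
theorem rotate (h : OddSquarefreeData k D₁ D₂ D₃) : OddSquarefreeData k D₂ D₃ D₁ :=
  ⟨h.factor, by convert h.odd using 1; ring, by convert h.squarefree using 1; ring⟩

theorem swap (h : OddSquarefreeData k D₁ D₂ D₃) : OddSquarefreeData k D₂ D₁ D₃ :=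
  ⟨h.factor, by convert h.odd using 1; ring, by convert h.squarefree using 1; ring⟩

theorem odd₁ (h : OddSquarefreeData k D₁ D₂ D₃) : Odd D₁ :=
  (Nat.odd_mul.mp (Nat.odd_mul.mp h.odd).1).1

theorem squarefree₁ (h : OddSquarefreeData k D₁ D₂ D₃) : Squarefree D₁ :=
  h.squarefree.squarefree_of_dvd ⟨D₂ * D₃, by ring⟩

theorem coprime₁₂ (h : OddSquarefreeData k D₁ D₂ D₃) : D₁.Coprime D₂ :=
  Nat.coprime_of_squarefree_mul (h.squarefree.squarefree_of_dvd ⟨D₃, rfl⟩)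

theorem ne_two_of_dvd (h : OddSquarefreeData k D₁ D₂ D₃) {p : ℕ} (hp : p ∣ D₁) : p ≠ 2 := by
  rintro rfl
  exact (Nat.not_even_iff_odd.mpr h.odd₁) (even_iff_two_dvd.mpr hp)

theorem not_dvd_factor (h : OddSquarefreeData k D₁ D₂ D₃) {p : ℕ} (hp : p.Prime) (hd : p ∣ D₁) :
    ¬ p ∣ k := by
  intro hk
  rcases h.factor with rfl | rfl
  · exact hp.one_lt.ne' (Nat.dvd_one.mp hk)
  · exact h.ne_two_of_dvd hd ((Nat.prime_dvd_prime_iff_eq hp Nat.prime_two).mp hk)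

theorem not_dvd₂ (h : OddSquarefreeData k D₁ D₂ D₃) {p : ℕ} (hp : p.Prime) (hd : p ∣ D₁) :
    ¬ p ∣ D₂ := fun hd2 => hp.one_lt.ne' (Nat.eq_one_of_dvd_coprimes h.coprime₁₂ hd hd2)

theorem not_dvd₃ (h : OddSquarefreeData k D₁ D₂ D₃) {p : ℕ} (hp : p.Prime) (hd : p ∣ D₁) :
    ¬ p ∣ D₃ := h.rotate.swap.rotate.rotate.not_dvd₂ hp hd

theorem not_sq_dvd (h : OddSquarefreeData k D₁ D₂ D₃) {p : ℕ} (hp : p.Prime) :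
    ¬ p ^ 2 ∣ D₁ := fun hd => hp.one_lt.ne' (Nat.isUnit_iff.mp (h.squarefree₁ p (sq p ▸ hd)))

theorem squarefree_factor_mul (h : OddSquarefreeData k D₁ D₂ D₃) :
    Squarefree (k * (D₁ * D₂ * D₃)) := by
  rcases h.factor with rfl | rfl
  · simpa using h.squarefree
  · exact (Nat.squarefree_mul (Nat.coprime_two_left.mpr h.odd)).mpr
      ⟨Nat.prime_two.squarefree, h.squarefree⟩

end OddSquarefreeData

theorem not_prime_dvd_mul {p : ℕ} (hp : p.Prime) {e : ℤ} (he : e = 1 ∨ e = -1) {a b c : ℕ}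
    (ha : ¬ p ∣ a) (hb : ¬ p ∣ b) (hc : ¬ p ∣ c) : ¬ (p : ℤ) ∣ e * a * b * c := by
  intro h
  have h' : (p : ℤ) ∣ ((a * b * c : ℕ) : ℤ) := by
    rcases he with rfl | rfl
    · push_cast; simpa using h
    · push_cast; simpa using h
  rw [Int.natCast_dvd_natCast, hp.dvd_mul, hp.dvd_mul] at h'
  tauto

section Criterion

variable {k D₁ D₂ D₃ : ℕ} {e₁ e₂ : ℤ}

theorem residue_of_isotropic (h : OddSquarefreeData k D₁ D₂ D₃) (he₁ : e₁ = 1 ∨ e₁ = -1)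
    (he₂ : e₂ = 1 ∨ e₂ = -1) (hiso : TernaryIsotropic (e₁ * D₁) (e₂ * D₂) (-(k * D₃))) :
    ResidueModPrimes (e₂ * k * D₂ * D₃) D₁ := by
  intro p hp
  have hpp := Nat.prime_of_mem_primeFactors hp
  have hd := Nat.dvd_of_mem_primeFactors hp
  rw [jacobiSym_prime_eq_one_iff hpp (not_prime_dvd_mul hpp he₂ (h.not_dvd_factor hpp hd)
    (h.not_dvd₂ hpp hd) (h.not_dvd₃ hpp hd))]
  have := hiso.isSquare hpp ((Int.natCast_dvd_natCast.mpr hd).mul_left e₁) (fun h2 => ?_)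
    (fun h3 => ?_)
  · convert this using 1
    push_cast
    ring
  · refine h.not_sq_dvd hpp ?_
    rw [← Int.natCast_dvd_natCast]
    rcases he₁ with rfl | rfl <;> simpa using h2
  · refine not_prime_dvd_mul hpp (Or.inr rfl) (h.not_dvd_factor hpp hd) (h.not_dvd₃ hpp hd)
      (c := 1) (fun h1 => hpp.one_lt.ne' (Nat.dvd_one.mp h1)) ?_
    simpa using h3

theorem residue_of_isotropic' (h : OddSquarefreeData k D₁ D₂ D₃) (he₁ : e₁ = 1 ∨ e₁ = -1)
    (he₂ : e₂ = 1 ∨ e₂ = -1) (hiso : TernaryIsotropic (e₁ * D₁) (e₂ * D₂) (-(k * D₃))) :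
    ResidueModPrimes (-(e₁ * e₂ * D₁ * D₂)) D₃ := by
  intro p hp
  have hpp := Nat.prime_of_mem_primeFactors hp
  have hd := Nat.dvd_of_mem_primeFactors hp
  have h' := h.rotate.rotate
  have he : -(e₁ * e₂) = 1 ∨ -(e₁ * e₂) = -1 := by
    rcases he₁ with rfl | rfl <;> rcases he₂ with rfl | rfl <;> simp
  have h1 : ¬ p ∣ 1 := fun h1 => hpp.one_lt.ne' (Nat.dvd_one.mp h1)
  have hnd := not_prime_dvd_mul hpp he (h'.not_dvd₂ hpp hd) (h'.not_dvd₃ hpp hd) h1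
  rw [jacobiSym_prime_eq_one_iff hpp (by simpa [mul_assoc] using hnd)]
  have := hiso.rotate.rotate.isSquare hpp
    (((Int.natCast_dvd_natCast.mpr hd).mul_left k).neg_right) (fun h2 => ?_)
    (fun h3 => ?_)
  · convert this using 1
    push_cast
    ring
  · refine h'.not_sq_dvd hpp ?_
    have hcop : (p ^ 2).Coprime k :=
      Nat.Coprime.pow_left 2 ((Nat.Prime.coprime_iff_not_dvd hpp).mpr (h'.not_dvd_factor hpp hd))
    refine hcop.dvd_of_dvd_mul_left ?_
    rw [← Int.natCast_dvd_natCast]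
    simpa using h2
  · refine not_prime_dvd_mul hpp he₂ (h'.not_dvd₃ hpp hd) h1 h1 ?_
    simpa using h3

theorem signs_of_isotropic (h : OddSquarefreeData k D₁ D₂ D₃)
    (hiso : TernaryIsotropic (e₁ * D₁) (e₂ * D₂) (-(k * D₃))) : (e₁, e₂) ≠ (-1, -1) := by
  intro he
  obtain ⟨rfl, rfl⟩ := Prod.mk.inj he
  obtain ⟨x, y, z, hne, hz⟩ := hiso
  have h1 : (0 : ℤ) < D₁ := by exact_mod_cast h.odd₁.pos
  have h2 : (0 : ℤ) < D₂ := by exact_mod_cast h.rotate.odd₁.pos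
  have h3 : (0 : ℤ) < D₃ := by exact_mod_cast h.rotate.rotate.odd₁.pos
  have hk : (0 : ℤ) < k := by rcases h.factor with rfl | rfl <;> norm_num
  have hkD := mul_pos hk h3
  have hx2 := mul_nonneg h1.le (sq_nonneg x)
  have hy2 := mul_nonneg h2.le (sq_nonneg y)
  have hz2 := mul_nonneg hkD.le (sq_nonneg z)
  have hx : (D₁ : ℤ) * x ^ 2 = 0 := by linarith
  have hy : (D₂ : ℤ) * y ^ 2 = 0 := by linarith
  have hzz : (k * D₃ : ℤ) * z ^ 2 = 0 := by linarith
  have hx0 := (mul_eq_zero.mp hx).resolve_left h1.ne'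
  have hy0 := (mul_eq_zero.mp hy).resolve_left h2.ne'
  have hz0 := (mul_eq_zero.mp hzz).resolve_left hkD.ne'
  simp [pow_eq_zero_iff] at hx0 hy0 hz0
  tauto

/-- Legendre's theorem needs two positive coefficients and one negative. Every sign pattern except
`(-1, -1)` reaches this shape after a permutation and, if necessary, a change of sign of the whole
form. -/
theorem isotropic_of_residues (h : OddSquarefreeData k D₁ D₂ D₃) (he₁ : e₁ = 1 ∨ e₁ = -1)
    (he₂ : e₂ = 1 ∨ e₂ = -1) (hne : (e₁, e₂) ≠ (-1, -1))
    (h₁ : ResidueModPrimes (e₂ * k * D₂ * D₃) D₁) (h₂ : ResidueModPrimes (e₁ * k * D₁ * D₃) D₂)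
    (h₃ : ResidueModPrimes (-(e₁ * e₂ * D₁ * D₂)) D₃) :
    TernaryIsotropic (e₁ * D₁) (e₂ * D₂) (-(k * D₃)) := by
  have hsq {m : ℤ} {n : ℕ} (hn : n ≠ 0) (hr : ResidueModPrimes m n) {p : ℕ} (hp : p.Prime)
      (hd : p ∣ n) : IsSquare (m : ZMod p) := by
    have hj := hr p (Nat.mem_primeFactors.mpr ⟨hp, hd, hn⟩)
    have : Fact p.Prime := ⟨hp⟩
    exact ZMod.isSquare_of_jacobiSym_eq_one hj
  have r₁ := fun {p} => hsq (p := p) h.odd₁.pos.ne' h₁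
  have r₂ := fun {p} => hsq (p := p) h.rotate.odd₁.pos.ne' h₂
  have r₃ : ∀ p : ℕ, p.Prime → p ∣ k * D₃ → IsSquare ((-(e₁ * e₂ * D₁ * D₂) : ℤ) : ZMod p) := by
    intro p hp hd
    rcases hp.dvd_mul.mp hd with hd | hd
    · have h2 : p = 2 := by
        rcases h.factor with rfl | rfl
        · exact absurd (Nat.dvd_one.mp hd) hp.one_lt.ne'
        · exact (Nat.prime_dvd_prime_iff_eq hp Nat.prime_two).mp hd
      subst h2
      -- The factor `k = 2` brings no condition, because every element of `ZMod 2` is a square.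
      generalize ((-(e₁ * e₂ * D₁ * D₂) : ℤ) : ZMod 2) = t
      exact ⟨t, by revert t; decide⟩
    · exact hsq h.rotate.rotate.odd₁.pos.ne' h₃ hp hd
  push_cast at r₁ r₂ r₃
  rcases he₁ with rfl | rfl <;> rcases he₂ with rfl | rfl
  · have := legendre_ternary (a := D₁) (b := D₂) (c := k * D₃)
      (by convert h.squarefree_factor_mul using 1; ring)
      (fun p hp hd => by convert r₁ hp hd using 1; push_cast; ring)
      (fun p hp hd => by convert r₂ hp hd using 1; push_cast; ring)
      (fun p hp hd => by convert r₃ p hp hd using 1; push_cast; ring)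
    simpa using this
  · have := legendre_ternary (a := D₂) (b := k * D₃) (c := D₁)
      (by convert h.squarefree_factor_mul using 1; ring)
      (fun p hp hd => by convert r₂ hp hd using 1; push_cast; ring)
      (fun p hp hd => by convert r₃ p hp hd using 1; push_cast; ring)
      (fun p hp hd => by convert r₁ hp hd using 1; push_cast; ring)
    simpa using this.neg.rotate.rotate
  · have := legendre_ternary (a := D₁) (b := k * D₃) (c := D₂)
      (by convert h.squarefree_factor_mul using 1; ring)
      (fun p hp hd => by convert r₁ hp hd using 1; push_cast; ring)
      (fun p hp hd => by convert r₃ p hp hd using 1; push_cast; ring)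
      (fun p hp hd => by convert r₂ hp hd using 1; push_cast; ring)
    simpa using this.neg.rotate.swap.rotate.rotate
  · exact absurd rfl hne

/-- Local-global criterion for `e₁ D₁ x² + e₂ D₂ y² = k D₃ z²`. -/
theorem isotropic_iff (h : OddSquarefreeData k D₁ D₂ D₃) (he₁ : e₁ = 1 ∨ e₁ = -1)
    (he₂ : e₂ = 1 ∨ e₂ = -1) :
    TernaryIsotropic (e₁ * D₁) (e₂ * D₂) (-(k * D₃)) ↔ (e₁, e₂) ≠ (-1, -1) ∧
      ResidueModPrimes (e₂ * k * D₂ * D₃) D₁ ∧ ResidueModPrimes (e₁ * k * D₁ * D₃) D₂ ∧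
      ResidueModPrimes (-(e₁ * e₂ * D₁ * D₂)) D₃ :=
  ⟨fun hi => ⟨signs_of_isotropic h hi, residue_of_isotropic h he₁ he₂ hi,
    residue_of_isotropic h.swap he₂ he₁ hi.swap, residue_of_isotropic' h he₁ he₂ hi⟩,
    fun ⟨hne, h₁, h₂, h₃⟩ => isotropic_of_residues h he₁ he₂ hne h₁ h₂ h₃⟩

end Criterion

/-! ### The symbol `η`, reciprocity and the condition at 2 -/

theorem exists_odd_zero {a b c : ℤ} (h : TernaryIsotropic a b c) :
    ∃ x y z : ℤ, (x % 2 ≠ 0 ∨ y % 2 ≠ 0 ∨ z % 2 ≠ 0) ∧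
      a * x ^ 2 + b * y ^ 2 + c * z ^ 2 = 0 := by
  obtain ⟨x, y, z, hn, h⟩ := h.exists_not_dvd Int.prime_two
  exact ⟨x, y, z, by omega, h⟩

theorem eta_eq {a b : ℤ} (ha : Odd a) (hb : Odd b) :
    eta a b = if a % 4 = 3 ∧ b % 4 = 3 then -1 else 1 := by
  obtain ⟨m, rfl⟩ := ha
  obtain ⟨n, rfl⟩ := hb
  have h1 : (2 * m + 1 - 1) / 2 = m := by omega
  have h2 : (2 * n + 1 - 1) / 2 = n := by omega
  rw [eta, h1, h2]
  rcases Int.even_or_odd (m * n) with h | h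
  · rw [Even.neg_one_zpow h, if_neg]
    · rfl
    · rcases Int.even_mul.mp h with h | h <;> obtain ⟨r, rfl⟩ := h <;> omega
  · rw [Odd.neg_one_zpow h, if_pos]
    · rfl
    · obtain ⟨⟨r, rfl⟩, ⟨s, rfl⟩⟩ := Int.odd_mul.mp h
      omega

theorem eta_congr {a a' b b' : ℤ} (ha : Odd a) (hb : Odd b) (haa : a % 4 = a' % 4)
    (hbb : b % 4 = b' % 4) : eta a b = eta a' b' := by
  have ha' : Odd a' := by rw [Int.odd_iff] at ha ⊢; omega
  have hb' : Odd b' := by rw [Int.odd_iff] at hb ⊢; omega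
  rw [eta_eq ha hb, eta_eq ha' hb', haa, hbb]

theorem eta_eq_one_of_left {a b : ℤ} (ha : a % 4 = 1) (hb : Odd b) : eta a b = 1 := by
  rw [eta_eq (Int.odd_iff.mpr (by omega)) hb, if_neg (by omega)]

theorem eta_eq_one_of_right {a b : ℤ} (ha : Odd a) (hb : b % 4 = 1) : eta a b = 1 := by
  rw [eta_eq ha (Int.odd_iff.mpr (by omega)), if_neg (by omega)]

theorem eta_eq_one_of_add {a b : ℤ} (ha : Odd a) (hb : Odd b) (h : (a + b) % 4 = 0) :
    eta a b = 1 := by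
  rw [Int.odd_iff] at ha hb
  rw [eta_eq (Int.odd_iff.mpr ha) (Int.odd_iff.mpr hb), if_neg (by omega)]

theorem jacobiSym_neg_one_eq {n : ℕ} (hn : Odd n) :
    jacobiSym (-1) n = if n % 4 = 3 then -1 else 1 := by
  rw [jacobiSym.at_neg_one hn, ZMod.χ₄_nat_eq_if_mod_four]
  rw [Nat.odd_iff] at hn
  split_ifs <;> omega

/-- For odd `b`, `b + 2 ≡ -b` mod `4`, so `η(a, b + 2) = η(a, b) (-1/a)`. In the cyclic product each
variable contributes its sign once. -/
theorem bigPhi_eq {a b c : ℕ} (ha : Odd a) (hb : Odd b) (hc : Odd c) :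
    bigPhi a b c = eta a b * eta a c * eta b c *
      (jacobiSym (-1) a * jacobiSym (-1) b * jacobiSym (-1) c) := by
  have ha' : Odd (a : ℤ) := by exact_mod_cast ha
  have hb' : Odd (b : ℤ) := by exact_mod_cast hb
  have hc' : Odd (c : ℤ) := by exact_mod_cast hc
  have h2 : ∀ {x : ℤ}, Odd x → Odd (x + 2) := fun h => h.add_even even_two
  rw [bigPhi, eta_eq ha' (h2 hb'), eta_eq hb' (h2 hc'), eta_eq hc' (h2 ha'), eta_eq ha' hb',
    eta_eq ha' hc', eta_eq hb' hc', jacobiSym_neg_one_eq ha, jacobiSym_neg_one_eq hb,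
    jacobiSym_neg_one_eq hc]
  rw [Nat.odd_iff] at ha hb hc
  have e1 : (a : ℤ) % 4 = (a % 4 : ℕ) := by omega
  have e2 : (b : ℤ) % 4 = (b % 4 : ℕ) := by omega
  have e3 : (c : ℤ) % 4 = (c % 4 : ℕ) := by omega
  rw [Int.add_emod (a : ℤ), Int.add_emod (b : ℤ), Int.add_emod (c : ℤ), e1, e2, e3]
  rcases (by omega : a % 4 = 1 ∨ a % 4 = 3) with h | h <;>
  rcases (by omega : b % 4 = 1 ∨ b % 4 = 3) with h' | h' <;>
  rcases (by omega : c % 4 = 1 ∨ c % 4 = 3) with h'' | h'' <;>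
  simp [h, h', h'']

theorem jacobiSym_mul_reciprocal {a b : ℕ} (ha : Odd a) (hb : Odd b) (hab : a.Coprime b) :
    jacobiSym a b * jacobiSym b a = eta a b := by
  have ha' : Odd (a : ℤ) := by exact_mod_cast ha
  have hb' : Odd (b : ℤ) := by exact_mod_cast hb
  have hsq : jacobiSym b a * jacobiSym b a = 1 := by
    rw [← sq]
    exact jacobiSym.sq_one (by simpa [Int.gcd_natCast_natCast] using hab.symm)
  rw [eta_eq ha' hb', jacobiSym.quadratic_reciprocity_if (Nat.odd_iff.mp ha) (Nat.odd_iff.mp hb)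
    |>.symm]
  rw [mul_comm]
  split_ifs with h1 h2 h2
  · rw [mul_neg, hsq]
  · omega
  · omega
  · exact hsq

/-- The 2-adic condition implied by solvability of `e₁ D₁ x² + e₂ D₂ y² = k D₃ z²`. -/
theorem eta_of_isotropic {k D₁ D₂ D₃ : ℕ} {e₁ e₂ : ℤ} (h : OddSquarefreeData k D₁ D₂ D₃)
    (he₁ : e₁ = 1 ∨ e₁ = -1) (he₂ : e₂ = 1 ∨ e₂ = -1)
    (hiso : TernaryIsotropic (e₁ * D₁) (e₂ * D₂) (-(k * D₃))) :
    eta (e₁ * D₁ * D₃) (e₂ * D₂ * D₃) * jacobiSym k (D₁ * D₂) = 1 := by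
  obtain ⟨x, y, z, hne, hz⟩ := exists_odd_zero hiso
  have o1 := h.odd₁
  have o2 := h.rotate.odd₁
  have o3 := h.rotate.rotate.odd₁
  have o12 : Odd (D₁ * D₂) := o1.mul o2
  have he1 : Odd e₁ := by rcases he₁ with rfl | rfl <;> decide
  have he2 : Odd e₂ := by rcases he₂ with rfl | rfl <;> decide
  have hA : Odd (e₁ * D₁ * D₃) := (he1.mul (by exact_mod_cast o1)).mul (by exact_mod_cast o3)
  have hB : Odd (e₂ * D₂ * D₃) := (he2.mul (by exact_mod_cast o2)).mul (by exact_mod_cast o3)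
  have hC : Odd (D₃ : ℤ) := by exact_mod_cast o3
  have hABD : (e₁ * D₁ * D₃) * (e₂ * D₂ * D₃) = e₁ * e₂ * (D₁ * D₂ : ℕ) * D₃ ^ 2 := by
    push_cast; ring
  -- Multiplying the equation by `D₃` gives `A x² + B y² = k w²` with `A`, `B` the arguments of `η`
  -- and `w = D₃ z`.
  have heq : (e₁ * D₁ * D₃) * x ^ 2 + (e₂ * D₂ * D₃) * y ^ 2 = k * (D₃ * z) ^ 2 := by
    linear_combination (D₃ : ℤ) * hz
  rw [eta_eq hA hB]
  generalize e₁ * D₁ * D₃ = A at *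
  generalize e₂ * D₂ * D₃ = B at *
  generalize (D₃ : ℤ) = C at *
  have hk := h.factor
  rcases hk with rfl | rfl
  · rw [if_neg]
    · simp
    rintro ⟨hA3, hB3⟩
    have hz4 : (A : ZMod 4) * x ^ 2 + B * y ^ 2 = (C * z : ℤ) ^ 2 := by
      have := congrArg (Int.cast : ℤ → ZMod 4) heq
      push_cast at this ⊢
      linear_combination this
    have c3 : ∀ {t : ℤ}, t % 4 = 3 → (t : ZMod 4) = 3 := fun {t} ht => by
      have : ((t % 4 : ℤ) : ZMod 4) = t := ZMod.intCast_mod t 4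
      rw [← this, ht]; rfl
    rw [c3 hA3, c3 hB3] at hz4
    -- For `A ≡ B ≡ 3` mod `4` the equation forces all three variables to be even, which the choice
    -- of a primitive zero excludes.
    have hdec : ∀ u v w : ZMod 4, 3 * u ^ 2 + 3 * v ^ 2 = w ^ 2 →
        2 * u = 0 ∧ 2 * v = 0 ∧ 2 * w = 0 := by decide
    obtain ⟨hx, hy, hw⟩ := hdec _ _ _ hz4
    have hev : ∀ {t : ℤ}, (2 : ZMod 4) * t = 0 → t % 2 = 0 := fun {t} ht => by
      have : ((2 * t : ℤ) : ZMod 4) = 0 := by push_cast; exact ht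
      have := (ZMod.intCast_zmod_eq_zero_iff_dvd _ 4).mp this
      omega
    have hw2 := hev hw
    have hz2 : z % 2 = 0 := by
      rw [← Int.even_iff] at hw2 ⊢
      exact (Int.even_mul.mp hw2).resolve_left (Int.not_even_iff_odd.mpr hC)
    have := hev hx
    have := hev hy
    omega
  · have hsq : ∀ t : ℤ, Odd t → ∃ i, t ^ 2 = 8 * i + 1 := fun t ht => by
      obtain ⟨i, hi⟩ := Int.eight_dvd_sq_sub_one_of_odd ht
      exact ⟨i, by linarith⟩
    have hsq0 : ∀ t : ℤ, Even t → ∃ i, t ^ 2 = 4 * i := fun t ⟨i, hi⟩ => ⟨i ^ 2, by rw [hi]; ring⟩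
    -- If `x` and `y` were both even, then `z` would be odd and `2 w² ≡ 2` mod `4`, while the left
    -- side is divisible by `4`. If exactly one were even, the left side would be odd.
    have hx : Odd x ∧ Odd y := by
      rcases Int.even_or_odd x with hx | hx <;> rcases Int.even_or_odd y with hy | hy
      · exfalso
        obtain ⟨i, hi⟩ := hsq0 x hx
        obtain ⟨j, hj⟩ := hsq0 y hy
        rw [hi, hj] at heq
        have hzo : Odd z := by
          rw [Int.even_iff] at hx hy
          rw [Int.odd_iff]
          omega
        obtain ⟨l, hl⟩ := hsq _ (hC.mul hzo)
        rw [hl] at heq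
        have : 4 * (A * i + B * j) = 2 * (8 * l + 1) := by
          push_cast at heq
          linear_combination heq
        omega
      · exfalso
        have h1 : Even (A * x ^ 2) := (hx.pow_of_ne_zero two_ne_zero).mul_left A
        have h2 : Odd (A * x ^ 2 + B * y ^ 2) := h1.add_odd (hB.mul hy.pow)
        rw [heq] at h2
        exact Int.not_even_iff_odd.mpr h2 (by simp)
      · exfalso
        have h1 : Even (B * y ^ 2) := (hy.pow_of_ne_zero two_ne_zero).mul_left B
        have h2 : Odd (A * x ^ 2 + B * y ^ 2) := (hA.mul hx.pow).add_even h1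
        rw [heq] at h2
        exact Int.not_even_iff_odd.mpr h2 (by simp)
      · exact ⟨hx, hy⟩
    -- Odd squares are `1` mod `8`, so the left side is `A + B` mod `8`, while `2 w²` is `0` or `2`.
    have hAB : (A + B) % 8 = 0 ∨ (A + B) % 8 = 2 := by
      obtain ⟨i, hi⟩ := hsq x hx.1
      obtain ⟨j, hj⟩ := hsq y hx.2
      rw [hi, hj] at heq
      push_cast at heq
      rcases Int.even_or_odd (C * z) with hw | hw
      · obtain ⟨l, hl⟩ := hsq0 _ hw
        rw [hl] at heq
        left
        have : A + B = 8 * (l - A * i - B * j) := by linear_combination heq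
        omega
      · obtain ⟨l, hl⟩ := hsq _ hw
        rw [hl] at heq
        right
        have : A + B = 8 * (2 * l - A * i - B * j) + 2 := by linear_combination heq
        omega
    -- `A B = ± D₁ D₂ D₃²` and `D₃² ≡ 1` mod `8`. The sign does not matter, as `(2/n)` depends only
    -- on `±n` mod `8`.
    have hn : ((D₁ * D₂ : ℕ) : ℤ) % 8 = A * B % 8 ∨ ((D₁ * D₂ : ℕ) : ℤ) % 8 = -(A * B) % 8 := by
      obtain ⟨c, hc⟩ := hsq C hC
      rw [hABD, hc]
      generalize ((D₁ * D₂ : ℕ) : ℤ) = n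
      have he : e₁ * e₂ = 1 ∨ e₁ * e₂ = -1 := by
        rcases he₁ with rfl | rfl <;> rcases he₂ with rfl | rfl <;> simp
      rcases he with he | he <;> rw [he]
      · left
        have : 1 * n * (8 * c + 1) = 8 * (n * c) + n := by ring
        omega
      · right
        have : -1 * n * (8 * c + 1) = -(8 * (n * c)) - n := by ring
        omega
    have hAm : A % 2 = 1 := Int.odd_iff.mp hA
    have hBm : B % 2 = 1 := Int.odd_iff.mp hB
    rw [Nat.cast_ofNat, jacobiSym.at_two o12, ZMod.χ₈_nat_eq_if_mod_eight,
      if_neg (c := D₁ * D₂ % 2 = 0) (by rw [Nat.odd_iff] at o12; omega)]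
    have hmul : A * B % 8 = (A % 8) * (B % 8) % 8 := Int.mul_emod A B 8
    generalize D₁ * D₂ = n at *
    rcases (by omega : A % 8 = 1 ∨ A % 8 = 3 ∨ A % 8 = 5 ∨ A % 8 = 7) with ha | ha | ha | ha <;>
    rcases (by omega : B % 8 = 1 ∨ B % 8 = 3 ∨ B % 8 = 5 ∨ B % 8 = 7) with hb | hb | hb | hb <;>
    rw [ha, hb] at hmul <;> norm_num at hmul <;> first
      | (exfalso; omega)
      | (rw [if_neg (by omega), if_pos (by omega)]; rfl)
      | (rw [if_pos (by omega), if_neg (by omega)]; rfl)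

/-! ### Residue conditions as averages of characters -/

/-- The Jacobi symbol as an arithmetic function of its lower entry. -/
def jacobiArith (m : ℤ) : ArithmeticFunction ℚ :=
  -- The value at `0` has to be overridden: `jacobiSym m 0` is `1`, whereas an arithmetic function
  -- vanishes at `0`.
  ⟨fun n => if n = 0 then 0 else jacobiSym m n, if_pos rfl⟩

theorem jacobiArith_apply (m : ℤ) {n : ℕ} (hn : n ≠ 0) : jacobiArith m n = jacobiSym m n :=
  if_neg hn

theorem jacobiArith_isMultiplicative (m : ℤ) : (jacobiArith m).IsMultiplicative := by
  rw [ArithmeticFunction.IsMultiplicative.iff_ne_zero]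
  refine ⟨by rw [jacobiArith_apply m one_ne_zero]; simp, fun {a b} ha hb _ => ?_⟩
  rw [jacobiArith_apply m (mul_ne_zero ha hb), jacobiArith_apply m ha, jacobiArith_apply m hb,
    jacobiSym.mul_right' m ha hb]
  push_cast
  rfl

theorem ArithmeticFunction.cardDistinctFactors_eq_card_primeFactors (n : ℕ) :
    ArithmeticFunction.cardDistinctFactors n = n.primeFactors.card := by
  rw [ArithmeticFunction.cardDistinctFactors_apply, Nat.primeFactors, List.card_toFinset]

open Classical in
/-- The residue conditions at the primes dividing `n` as a normalised character sum. -/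
theorem sum_jacobiSym_divisorsAntidiagonal {n : ℕ} (hn : Squarefree n) {m : ℤ}
    (hm : m.gcd n = 1) :
    ∑ x ∈ n.divisorsAntidiagonal, (jacobiSym m x.1 : ℚ) =
      2 ^ ArithmeticFunction.cardDistinctFactors n * if ResidueModPrimes m n then 1 else 0 := by
  have h1 : ∑ x ∈ n.divisorsAntidiagonal, (jacobiSym m x.1 : ℚ) =
      ∑ d ∈ n.divisors, jacobiArith m d := by
    rw [Nat.sum_divisorsAntidiagonal (f := fun a _ => (jacobiSym m a : ℚ))]
    exact Finset.sum_congr rfl fun d hd =>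
      (jacobiArith_apply m (Nat.pos_of_mem_divisors hd).ne').symm
  -- By multiplicativity the sum is `∏ (1 + (m/p))` over `p ∣ n`; coprimality makes every factor `2`
  -- or `0`.
  rw [h1, ← (jacobiArith_isMultiplicative m).prodPrimeFactors_one_add_of_squarefree hn,
    ArithmeticFunction.cardDistinctFactors_eq_card_primeFactors]
  have h2 : ∀ p ∈ n.primeFactors, jacobiArith m p = jacobiSym m p := fun p hp =>
    jacobiArith_apply m (Nat.prime_of_mem_primeFactors hp).ne_zero
  split_ifs with h
  · rw [mul_one, ← Finset.prod_const]
    refine Finset.prod_congr rfl fun p hp => ?_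
    rw [h2 p hp, h p hp]
    norm_num
  · rw [mul_zero]
    unfold ResidueModPrimes at h
    push Not at h
    obtain ⟨p, hp, hne⟩ := h
    refine Finset.prod_eq_zero hp ?_
    have hgcd : m.gcd p = 1 := Nat.Coprime.coprime_dvd_right (Nat.dvd_of_mem_primeFactors hp) hm
    rw [h2 p hp, (jacobiSym.eq_one_or_neg_one hgcd).resolve_left hne]
    norm_num

/-! ### Primes congruent to 1 mod 4 -/

/-- Every prime divisor of `n` is `≡ 1 mod 4`. -/
def PrimesOneModFour (n : ℕ) : Prop := ∀ p ∈ n.primeFactors, p % 4 = 1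

theorem PrimesOneModFour.mod_four {n : ℕ} (h : PrimesOneModFour n) (hn : n ≠ 0) : n % 4 = 1 := by
  induction n using induction_on_primes with
  | zero => exact absurd rfl hn
  | one => rfl
  | prime_mul p a hp ih =>
    have ha : a ≠ 0 := right_ne_zero_of_mul hn
    have h1 : p % 4 = 1 := h p (Nat.mem_primeFactors.mpr ⟨hp, Dvd.intro _ rfl, hn⟩)
    have h2 := ih (fun q hq => h q (Nat.primeFactors_mono (Dvd.intro_left _ rfl) hn hq)) ha
    rw [Nat.mul_mod, h1, h2]

theorem PrimesOneModFour.of_dvd {d n : ℕ} (h : PrimesOneModFour n) (hn : n ≠ 0) (hd : d ∣ n) :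
    PrimesOneModFour d := fun q hq => h q (Nat.primeFactors_mono hd hn hq)

theorem primesOneModFour_mul {a b : ℕ} (ha : a ≠ 0) (hb : b ≠ 0) :
    PrimesOneModFour (a * b) ↔ PrimesOneModFour a ∧ PrimesOneModFour b := by
  unfold PrimesOneModFour
  rw [Nat.primeFactors_mul ha hb]
  simp only [Finset.mem_union]
  exact ⟨fun h => ⟨fun p hp => h p (Or.inl hp), fun p hp => h p (Or.inr hp)⟩,
    fun h p hp => hp.elim (h.1 p) (h.2 p)⟩

open Classical in
theorem psiOneModFour_eq (n : ℕ) : psiOneModFour n = if PrimesOneModFour n then 1 else 0 := by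
  unfold psiOneModFour PrimesOneModFour
  congr

theorem jacobiSym_neg_prime {p n : ℕ} (hn : Odd n) (hp : p ∈ n.primeFactors) (m : ℤ) :
    jacobiSym (-m) p = (if p % 4 = 1 then 1 else -1) * jacobiSym m p := by
  have hpo : Odd p := hn.of_dvd_nat (Nat.dvd_of_mem_primeFactors hp)
  rw [jacobiSym.neg m hpo, ZMod.χ₄_nat_eq_if_mod_four,
    if_neg (c := p % 2 = 0) (by rw [Nat.odd_iff] at hpo; omega)]

/-- If `m` and `-m` are both residues modulo `p`, so is `-1`. This is how `ψ` enters when two conics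
are solvable at once. -/
theorem ResidueModPrimes.primesOneModFour {m : ℤ} {n : ℕ} (hn : Odd n)
    (h : ResidueModPrimes m n) (h' : ResidueModPrimes (-m) n) : PrimesOneModFour n := by
  intro p hp
  have h1 := h p hp
  have h2 := h' p hp
  rw [jacobiSym_neg_prime hn hp, h1] at h2
  by_contra hcon
  rw [if_neg hcon] at h2
  norm_num at h2

theorem residueModPrimes_neg_iff {m : ℤ} {n : ℕ} (hn : Odd n) (h : PrimesOneModFour n) :
    ResidueModPrimes (-m) n ↔ ResidueModPrimes m n := by
  refine forall₂_congr fun p hp => ?_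
  rw [jacobiSym_neg_prime hn hp, if_pos (h p hp), one_mul]

theorem OddSquarefreeData.of_dvd {k D₁ D₂ D₃ a b c : ℕ} (h : OddSquarefreeData k D₁ D₂ D₃)
    (ha : a ∣ D₁) (hb : b ∣ D₂) (hc : c ∣ D₃) : OddSquarefreeData k a b c :=
  ⟨h.factor, h.odd.of_dvd_nat (mul_dvd_mul (mul_dvd_mul ha hb) hc),
    h.squarefree.squarefree_of_dvd (mul_dvd_mul (mul_dvd_mul ha hb) hc)⟩

theorem OddSquarefreeData.gcd_eq_one {k D₁ D₂ D₃ : ℕ} {e : ℤ} (h : OddSquarefreeData k D₁ D₂ D₃)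
    (he : e = 1 ∨ e = -1) : (e * k * D₂ * D₃).gcd D₁ = 1 := by
  rw [← Int.isCoprime_iff_gcd_eq_one]
  have h1 : IsCoprime (k : ℤ) D₁ := by
    rw [Nat.isCoprime_iff_coprime]
    rcases h.factor with rfl | rfl
    · exact Nat.coprime_one_left _
    · exact Nat.coprime_two_left.mpr h.odd₁
  have h2 : IsCoprime (D₂ : ℤ) D₁ := Nat.isCoprime_iff_coprime.mpr h.coprime₁₂.symm
  have h3 : IsCoprime (D₃ : ℤ) D₁ := Nat.isCoprime_iff_coprime.mpr h.rotate.rotate.coprime₁₂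
  have h0 : IsCoprime e (D₁ : ℤ) := by
    rcases he with rfl | rfl
    · exact isCoprime_one_left
    · exact isCoprime_one_left.neg_left
  exact ((h0.mul_left h1).mul_left h2).mul_left h3

theorem OddSquarefreeData.gcd_eq_one' {k D₁ D₂ D₃ : ℕ} {s e₁ e₂ : ℤ}
    (h : OddSquarefreeData k D₁ D₂ D₃) (hs : s = 1 ∨ s = -1)
    (he₁ : e₁ = 1 ∨ e₁ = -1) (he₂ : e₂ = 1 ∨ e₂ = -1) :
    (s * (e₁ * e₂ * D₁ * D₂)).gcd D₃ = 1 := by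
  have h1 : OddSquarefreeData 1 D₃ D₁ D₂ := ⟨Or.inl rfl, h.rotate.rotate.odd, h.rotate.rotate.squarefree⟩
  have he : s * (e₁ * e₂) = 1 ∨ s * (e₁ * e₂) = -1 := by
    rcases hs with rfl | rfl <;> rcases he₁ with rfl | rfl <;> rcases he₂ with rfl | rfl <;> simp
  have := h1.gcd_eq_one he
  convert this using 2
  push_cast
  ring

open Classical in
/-- A divisor sum whose weight is a constant times a product of three characters. -/
theorem divisorSum_characters {k D₁ D₂ D₃ : ℕ} (h : OddSquarefreeData k D₁ D₂ D₃)
    {m₁ m₂ m₃ : ℤ} (h₁ : m₁.gcd D₁ = 1) (h₂ : m₂.gcd D₂ = 1) (h₃ : m₃.gcd D₃ = 1) :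
    ∑ p ∈ D₁.divisorsAntidiagonal, ∑ q ∈ D₂.divisorsAntidiagonal,
      ∑ r ∈ D₃.divisorsAntidiagonal,
        (jacobiSym m₁ p.1 * jacobiSym m₂ q.1 * jacobiSym m₃ r.1 : ℚ) *
          (1 / 2 ^ DTuple.omega ⟨p.1, p.2, q.1, q.2, r.1, r.2⟩) =
      if ResidueModPrimes m₁ D₁ ∧ ResidueModPrimes m₂ D₂ ∧ ResidueModPrimes m₃ D₃
        then 1 else 0 := by
  -- The exponent `ω` is the same for all factorizations, so the triple sum splits into a product of
  -- three divisor sums.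
  have hom : ∀ p ∈ D₁.divisorsAntidiagonal, ∀ q ∈ D₂.divisorsAntidiagonal,
      ∀ r ∈ D₃.divisorsAntidiagonal, DTuple.omega ⟨p.1, p.2, q.1, q.2, r.1, r.2⟩ =
        ArithmeticFunction.cardDistinctFactors D₁ + ArithmeticFunction.cardDistinctFactors D₂ +
          ArithmeticFunction.cardDistinctFactors D₃ := by
    intro p hp q hq r hr
    rw [Nat.mem_divisorsAntidiagonal] at hp hq hr
    rw [DTuple.omega, ← ArithmeticFunction.cardDistinctFactors_mul h.coprime₁₂,
      ← ArithmeticFunction.cardDistinctFactors_mul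
        (Nat.Coprime.mul_left h.rotate.rotate.coprime₁₂.symm h.rotate.coprime₁₂)]
    congr 1
    simp only
    rw [← hp.1, ← hq.1, ← hr.1]
    ring
  have hstep : ∑ p ∈ D₁.divisorsAntidiagonal, ∑ q ∈ D₂.divisorsAntidiagonal,
      ∑ r ∈ D₃.divisorsAntidiagonal,
        (jacobiSym m₁ p.1 * jacobiSym m₂ q.1 * jacobiSym m₃ r.1 : ℚ) *
          (1 / 2 ^ DTuple.omega ⟨p.1, p.2, q.1, q.2, r.1, r.2⟩) =
      ((∑ p ∈ D₁.divisorsAntidiagonal, (jacobiSym m₁ p.1 : ℚ)) *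
        (∑ q ∈ D₂.divisorsAntidiagonal, (jacobiSym m₂ q.1 : ℚ)) *
        (∑ r ∈ D₃.divisorsAntidiagonal, (jacobiSym m₃ r.1 : ℚ))) *
        (1 / 2 ^ (ArithmeticFunction.cardDistinctFactors D₁ +
          ArithmeticFunction.cardDistinctFactors D₂ +
          ArithmeticFunction.cardDistinctFactors D₃)) := by
    rw [Finset.sum_mul_sum, Finset.sum_mul, Finset.sum_mul]
    refine Finset.sum_congr rfl fun p hp => ?_
    rw [Finset.sum_mul, Finset.sum_mul]
    refine Finset.sum_congr rfl fun q hq => ?_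
    rw [Finset.mul_sum, Finset.sum_mul]
    refine Finset.sum_congr rfl fun r hr => ?_
    rw [hom p hp q hq r hr]
  rw [hstep, sum_jacobiSym_divisorsAntidiagonal h.squarefree₁ h₁,
    sum_jacobiSym_divisorsAntidiagonal h.rotate.squarefree₁ h₂,
    sum_jacobiSym_divisorsAntidiagonal h.rotate.rotate.squarefree₁ h₃, pow_add, pow_add]
  by_cases c₁ : ResidueModPrimes m₁ D₁ <;> by_cases c₂ : ResidueModPrimes m₂ D₂ <;>
    by_cases c₃ : ResidueModPrimes m₃ D₃ <;> simp [c₁, c₂, c₃]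
  field_simp

/-- Quadratic reciprocity applied to the product of the three characters. -/
theorem jacobiSym_product_eq {k a a' b b' c c' : ℕ} {e₁ e₂ s : ℤ}
    (h : OddSquarefreeData k (a * a') (b * b') (c * c')) :
    jacobiSym (e₂ * k * (b * b' : ℕ) * (c * c' : ℕ)) a *
        jacobiSym (e₁ * k * (a * a' : ℕ) * (c * c' : ℕ)) b *
        jacobiSym (s * (e₁ * e₂ * (a * a' : ℕ) * (b * b' : ℕ))) c =
      jacobiSym e₁ (b * c) * jacobiSym e₂ (a * c) * jacobiSym k (a * b) * jacobiSym s c *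
        (eta a b * eta a c * eta b c) * DTuple.g ⟨a, a', b, b', c, c'⟩ := by
  have h' := h.of_dvd (Dvd.intro _ rfl : a ∣ a * a') (Dvd.intro _ rfl : b ∣ b * b')
    (Dvd.intro _ rfl : c ∣ c * c')
  have oa := h'.odd₁
  have ob := h'.rotate.odd₁
  have oc := h'.rotate.rotate.odd₁
  have na := oa.pos.ne'
  have nb := ob.pos.ne'
  have nc := oc.pos.ne'
  -- Each `η` is split into a symbol and its reciprocal. These six symbols are the part of the left
  -- side pairing `a`, `b`, `c` with each other; the symbols of the complementary factors `a'`,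
  -- `b'`, `c'` form `g`.
  rw [← jacobiSym_mul_reciprocal oa ob h'.coprime₁₂,
    ← jacobiSym_mul_reciprocal oa oc h'.rotate.rotate.coprime₁₂.symm,
    ← jacobiSym_mul_reciprocal ob oc h'.rotate.coprime₁₂, DTuple.g]
  push_cast
  simp only [jacobiSym.mul_left, jacobiSym.mul_right' _ na nb, jacobiSym.mul_right' _ na nc,
    jacobiSym.mul_right' _ nb nc]
  ring

/-! ### The weights for both parities at once -/

namespace DTuple

/-- The part of the weights built from reciprocity symbols, with `2` replaced by `k`. -/
def reciprocityTerms (k : ℕ) (ε₁ ε₂ : ℤ) (D : DTuple) : ℚ :=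
  ((if (ε₁, ε₂) ≠ (1, -1) then 1 else 0)
        * (1 / 2 * (1 + eta (ε₁ * D.D1 * D.D3 + 2) (ε₂ * D.D2 * D.D3)
            * jacobiSym k (D.D1 * D.D2)))
        * jacobiSym (-1) (D.D11 * D.D31)
    + (if (ε₁, ε₂) ≠ (-1, 1) then 1 else 0)
        * (1 / 2 * (1 + eta (ε₁ * D.D1 * D.D3) (ε₂ * D.D2 * D.D3 + 2)
            * jacobiSym k (D.D1 * D.D2)))
        * jacobiSym (-1) (D.D21 * D.D31)
    + (if (ε₁, ε₂) ≠ (-1, -1) then 1 else 0)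
        * (1 / 2 * (1 + eta (ε₁ * D.D1 * D.D3) (ε₂ * D.D2 * D.D3)
            * jacobiSym k (D.D1 * D.D2)))
        * jacobiSym (-1) (D.D11 * D.D21))
      * jacobiSym ε₁ (D.D21 * D.D31) * jacobiSym ε₂ (D.D11 * D.D31)
      * jacobiSym k (D.D11 * D.D21) * bigPhi D.D11 D.D21 D.D31

/-- The weight `F_even` with `2` replaced by `k`. -/
def weight (k : ℕ) (ε₁ ε₂ : ℤ) (D : DTuple) : ℚ :=
  D.reciprocityTerms k ε₁ ε₂ + D.psiTerms ε₁ ε₂ * jacobiSym k (D.D11 * D.D21)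
      * (1 / 2 * (1 + jacobiSym k (D.D1 * D.D2)))

theorem weight_two (ε₁ ε₂ : ℤ) : weight 2 ε₁ ε₂ = FEven ε₁ ε₂ := by
  funext D
  simp only [weight, reciprocityTerms, FEven, Nat.cast_ofNat]

theorem weight_one (ε₁ ε₂ : ℤ) : weight 1 ε₁ ε₂ = FOdd ε₁ ε₂ := by
  funext D
  simp only [weight, reciprocityTerms, FOdd, Nat.cast_one, jacobiSym.one_left, Int.cast_one,
    mul_one]
  norm_num

end DTuple

theorem jacobiSym_neg_one_mul_self {n : ℕ} (hn : Odd n) :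
    jacobiSym (-1) n * jacobiSym (-1) n = 1 := by
  rw [jacobiSym_neg_one_eq hn]
  split_ifs <;> rfl

/-- The half-sum of `1` and the 2-adic symbol, together with the sign condition. -/
def archimedeanTwoAdicFactor (k D₁ D₂ D₃ : ℕ) (e₁ e₂ : ℤ) : ℚ :=
  (if (e₁, e₂) ≠ (-1, -1) then 1 else 0) *
    (1 / 2 * (1 + eta (e₁ * D₁ * D₃) (e₂ * D₂ * D₃) * jacobiSym k (D₁ * D₂)))

/-- The product of the three characters, as in `jacobiSym_product_eq`. -/
def characterProduct (k : ℕ) (e₁ e₂ s : ℤ) (D : DTuple) : ℤ :=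
  jacobiSym (e₂ * k * D.D2 * D.D3) D.D11 * jacobiSym (e₁ * k * D.D1 * D.D3) D.D21 *
    jacobiSym (s * (e₁ * e₂ * D.D1 * D.D2)) D.D31

theorem pair_neg_ne_iff₁ {e₁ e₂ : ℤ} : (-e₁, e₂) ≠ ((-1 : ℤ), (-1 : ℤ)) ↔ (e₁, e₂) ≠ (1, -1) := by
  simp [neg_eq_iff_eq_neg]

theorem pair_neg_ne_iff₂ {e₁ e₂ : ℤ} : (e₁, -e₂) ≠ ((-1 : ℤ), (-1 : ℤ)) ↔ (e₁, e₂) ≠ (-1, 1) := by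
  simp [neg_eq_iff_eq_neg]

/-- Here `u`, `v`, `w` are the values of `(-1/·)` at `D₁₁`, `D₂₁`, `D₃₁`, and `E` is the product of
the three `η`, so that `E u v w` is `Φ`. The signs in the weight cancel against `Φ` and leave
exactly those caused by `-e₁`, by `-e₂` and by `s = -1`. -/
theorem sign_identity {R : Type*} [CommRing R] {u v w : R} (A₁ A₂ A₃ P Q K E G : R)
    (hu : u ^ 2 = 1) (hv : v ^ 2 = 1) :
    (A₁ * (u * w) + A₂ * (v * w) + A₃ * (u * v)) * P * Q * K * (E * (u * v * w)) * G =
      A₁ * (v * w * P * Q * K * w * E * G) + A₂ * (P * (u * w * Q) * K * w * E * G) +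
        A₃ * (P * Q * K * w * E * G) := by
  linear_combination P * Q * K * E * G * ((A₁ * v * w ^ 2 + A₃ * w * v ^ 2) * hu +
    (A₂ * u * w ^ 2 + A₃ * w) * hv)

/-- The three summands in braces belong to the conics with signs `(-e₁, e₂)`, `(e₁, -e₂)` and `(e₁,
e₂)`: for odd `x`, `x + 2 ≡ -x` mod `4`, so a shift by `2` inside `η` is a change of sign. -/
theorem reciprocityTerms_mul_g {k : ℕ} {D : DTuple} {e₁ e₂ : ℤ}
    (h : OddSquarefreeData k D.D1 D.D2 D.D3) (he₁ : e₁ = 1 ∨ e₁ = -1) (he₂ : e₂ = 1 ∨ e₂ = -1) :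
    D.reciprocityTerms k e₁ e₂ * D.g =
      archimedeanTwoAdicFactor k D.D1 D.D2 D.D3 (-e₁) e₂ * characterProduct k (-e₁) e₂ (-1) D +
      archimedeanTwoAdicFactor k D.D1 D.D2 D.D3 e₁ (-e₂) * characterProduct k e₁ (-e₂) (-1) D +
      archimedeanTwoAdicFactor k D.D1 D.D2 D.D3 e₁ e₂ * characterProduct k e₁ e₂ (-1) D := by
  obtain ⟨a, a', b, b', c, c'⟩ := D
  have h' := h.of_dvd (Dvd.intro _ rfl : a ∣ a * a') (Dvd.intro _ rfl : b ∣ b * b')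
    (Dvd.intro _ rfl : c ∣ c * c')
  have oa := h'.odd₁
  have ob := h'.rotate.odd₁
  have oc := h'.rotate.rotate.odd₁
  have na := oa.pos.ne'
  have nb := ob.pos.ne'
  have nc := oc.pos.ne'
  have hA : ∀ {e : ℤ}, e = 1 ∨ e = -1 → Odd (e * (a * a' : ℕ) * (c * c' : ℕ)) := fun he =>
    ((by rcases he with rfl | rfl <;> decide : Odd _).mul (by exact_mod_cast h.odd₁)).mul
      (by exact_mod_cast h.rotate.rotate.odd₁)
  have hB : ∀ {e : ℤ}, e = 1 ∨ e = -1 → Odd (e * (b * b' : ℕ) * (c * c' : ℕ)) := fun he =>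
    ((by rcases he with rfl | rfl <;> decide : Odd _).mul (by exact_mod_cast h.rotate.odd₁)).mul
      (by exact_mod_cast h.rotate.rotate.odd₁)
  have m4 : ∀ {x : ℤ}, Odd x → (x + 2) % 4 = (-x) % 4 := fun {x} hx => by
    rw [Int.odd_iff] at hx; omega
  have hη₁ : eta (e₁ * (a * a' : ℕ) * (c * c' : ℕ) + 2) (e₂ * (b * b' : ℕ) * (c * c' : ℕ)) =
      eta (-e₁ * (a * a' : ℕ) * (c * c' : ℕ)) (e₂ * (b * b' : ℕ) * (c * c' : ℕ)) :=
    eta_congr ((hA he₁).add_even even_two) (hB he₂) (by rw [m4 (hA he₁)]; ring_nf) rfl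
  have hη₂ : eta (e₁ * (a * a' : ℕ) * (c * c' : ℕ)) (e₂ * (b * b' : ℕ) * (c * c' : ℕ) + 2) =
      eta (e₁ * (a * a' : ℕ) * (c * c' : ℕ)) (-e₂ * (b * b' : ℕ) * (c * c' : ℕ)) :=
    eta_congr (hA he₁) ((hB he₂).add_even even_two) rfl (by rw [m4 (hB he₂)]; ring_nf)
  have hneg : ∀ (e : ℤ) (n : ℕ), jacobiSym (-e) n = jacobiSym (-1) n * jacobiSym e n := fun e n => by
    rw [← jacobiSym.mul_left, neg_one_mul]
  have sa : (jacobiSym (-1) a : ℚ) ^ 2 = 1 := by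
    rw [sq]; exact_mod_cast jacobiSym_neg_one_mul_self oa
  have sb : (jacobiSym (-1) b : ℚ) ^ 2 = 1 := by
    rw [sq]; exact_mod_cast jacobiSym_neg_one_mul_self ob
  simp only [DTuple.reciprocityTerms, archimedeanTwoAdicFactor, characterProduct, DTuple.D1,
    DTuple.D2, DTuple.D3, pair_neg_ne_iff₁, pair_neg_ne_iff₂, jacobiSym_product_eq h, hη₁, hη₂]
  rw [bigPhi_eq oa ob oc, hneg e₁, hneg e₂]
  simp only [jacobiSym.mul_right' _ na nb, jacobiSym.mul_right' _ na nc,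
    jacobiSym.mul_right' _ nb nc]
  push_cast
  generalize (jacobiSym (-1) a : ℚ) = u at *
  generalize (jacobiSym (-1) b : ℚ) = v at *
  generalize (jacobiSym (-1) c : ℚ) = w at *
  exact sign_identity _ _ _ _ _ _ _ _ sa sb

theorem jacobiSym_sign_eq_one {e : ℤ} (he : e = 1 ∨ e = -1) {n : ℕ} (hn : n % 4 = 1) :
    jacobiSym e n = 1 := by
  rcases he with rfl | rfl
  · exact jacobiSym.one_left n
  · rw [jacobiSym_neg_one_eq (Nat.odd_iff.mpr (by omega)), if_neg (by omega)]

theorem jacobiSym_sign_mul_self {e : ℤ} (he : e = 1 ∨ e = -1) {n : ℕ} (hn : Odd n) :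
    jacobiSym e n * jacobiSym e n = 1 := by
  rcases he with rfl | rfl
  · simp
  · exact jacobiSym_neg_one_mul_self hn

/-! ### The `ψ`-terms as character products -/

section PsiTerms

variable {k : ℕ} {D : DTuple} {e₁ e₂ : ℤ}

/-- The entries `D₁₁` and `D₂₁` are `1` mod `4`, so all `η`-factors and the signs at these entries
are trivial. Equality of the two signs makes the remaining symbol at `D₃₁` a square. -/
theorem characterProduct_of_primes₁₂ (h : OddSquarefreeData k D.D1 D.D2 D.D3)
    (he : e₁ = 1 ∨ e₁ = -1) (h₁ : PrimesOneModFour D.D1) (h₂ : PrimesOneModFour D.D2) :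
    characterProduct k e₁ e₁ 1 D = jacobiSym k (D.D11 * D.D21) * D.g := by
  obtain ⟨a, a', b, b', c, c'⟩ := D
  have h' := h.of_dvd (Dvd.intro _ rfl : a ∣ a * a') (Dvd.intro _ rfl : b ∣ b * b')
    (Dvd.intro _ rfl : c ∣ c * c')
  have oa := h'.odd₁
  have ob := h'.rotate.odd₁
  have oc := h'.rotate.rotate.odd₁
  have ma := (h₁.of_dvd h.odd₁.pos.ne' (Dvd.intro _ rfl : a ∣ a * a')).mod_four oa.pos.ne'
  have mb := (h₂.of_dvd h.rotate.odd₁.pos.ne' (Dvd.intro _ rfl : b ∣ b * b')).mod_four ob.pos.ne'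
  simp only [characterProduct, DTuple.D1, DTuple.D2, DTuple.D3, jacobiSym_product_eq h]
  rw [eta_eq_one_of_left (a := a) (by omega) (by exact_mod_cast ob),
    eta_eq_one_of_left (a := a) (by omega) (by exact_mod_cast oc),
    eta_eq_one_of_left (a := b) (by omega) (by exact_mod_cast oc),
    jacobiSym.mul_right' _ ob.pos.ne' oc.pos.ne', jacobiSym.mul_right' _ oa.pos.ne' oc.pos.ne',
    jacobiSym_sign_eq_one he ma, jacobiSym_sign_eq_one he mb, jacobiSym.one_left]
  linear_combination (jacobiSym k (a * b) * DTuple.g ⟨a, a', b, b', c, c'⟩) *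
    jacobiSym_sign_mul_self he oc

theorem characterProduct_of_primes₂₃ (h : OddSquarefreeData k D.D1 D.D2 D.D3)
    (he : e₁ = 1 ∨ e₁ = -1) (h₂ : PrimesOneModFour D.D2) (h₃ : PrimesOneModFour D.D3) :
    characterProduct k e₁ 1 1 D = jacobiSym k (D.D11 * D.D21) * D.g := by
  obtain ⟨a, a', b, b', c, c'⟩ := D
  have h' := h.of_dvd (Dvd.intro _ rfl : a ∣ a * a') (Dvd.intro _ rfl : b ∣ b * b')
    (Dvd.intro _ rfl : c ∣ c * c')
  have oa := h'.odd₁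
  have ob := h'.rotate.odd₁
  have oc := h'.rotate.rotate.odd₁
  have mb := (h₂.of_dvd h.rotate.odd₁.pos.ne' (Dvd.intro _ rfl : b ∣ b * b')).mod_four ob.pos.ne'
  have mc := (h₃.of_dvd h.rotate.rotate.odd₁.pos.ne' (Dvd.intro _ rfl : c ∣ c * c')).mod_four
    oc.pos.ne'
  simp only [characterProduct, DTuple.D1, DTuple.D2, DTuple.D3, jacobiSym_product_eq h]
  rw [eta_eq_one_of_right (b := b) (by exact_mod_cast oa) (by omega),
    eta_eq_one_of_right (b := c) (by exact_mod_cast oa) (by omega),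
    eta_eq_one_of_left (a := b) (by omega) (by exact_mod_cast oc),
    jacobiSym.mul_right' _ ob.pos.ne' oc.pos.ne',
    jacobiSym_sign_eq_one he mc, jacobiSym_sign_eq_one he mb]
  simp

theorem characterProduct_of_primes₁₃ (h : OddSquarefreeData k D.D1 D.D2 D.D3)
    (he : e₂ = 1 ∨ e₂ = -1) (h₁ : PrimesOneModFour D.D1) (h₃ : PrimesOneModFour D.D3) :
    characterProduct k 1 e₂ 1 D = jacobiSym k (D.D11 * D.D21) * D.g := by
  obtain ⟨a, a', b, b', c, c'⟩ := D
  have h' := h.of_dvd (Dvd.intro _ rfl : a ∣ a * a') (Dvd.intro _ rfl : b ∣ b * b')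
    (Dvd.intro _ rfl : c ∣ c * c')
  have oa := h'.odd₁
  have ob := h'.rotate.odd₁
  have oc := h'.rotate.rotate.odd₁
  have ma := (h₁.of_dvd h.odd₁.pos.ne' (Dvd.intro _ rfl : a ∣ a * a')).mod_four oa.pos.ne'
  have mc := (h₃.of_dvd h.rotate.rotate.odd₁.pos.ne' (Dvd.intro _ rfl : c ∣ c * c')).mod_four
    oc.pos.ne'
  simp only [characterProduct, DTuple.D1, DTuple.D2, DTuple.D3, jacobiSym_product_eq h]
  rw [eta_eq_one_of_left (a := a) (by omega) (by exact_mod_cast ob),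
    eta_eq_one_of_left (a := a) (by omega) (by exact_mod_cast oc),
    eta_eq_one_of_right (b := c) (by exact_mod_cast ob) (by omega),
    jacobiSym.mul_right' _ oa.pos.ne' oc.pos.ne',
    jacobiSym_sign_eq_one he mc, jacobiSym_sign_eq_one he ma]
  simp

-- The sign condition attached to each `ψ` is the one under which the matching
-- `characterProduct_of_primes` lemma applies: `e₁ = e₂`, `e₂ = 1` or `e₁ = 1`. Where no `ψ`
-- survives, both sides vanish.
open Classical in
theorem psiTerms_mul_g (h : OddSquarefreeData k D.D1 D.D2 D.D3)
    (he₁ : e₁ = 1 ∨ e₁ = -1) (he₂ : e₂ = 1 ∨ e₂ = -1) :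
    D.psiTerms e₁ e₂ * jacobiSym k (D.D11 * D.D21) * D.g =
      D.psiTerms e₁ e₂ * characterProduct k e₁ e₂ 1 D := by
  have n₁ := h.odd₁.pos.ne'
  have n₂ := h.rotate.odd₁.pos.ne'
  have n₃ := h.rotate.rotate.odd₁.pos.ne'
  simp only [DTuple.psiTerms, psiOneModFour_eq, primesOneModFour_mul (mul_ne_zero n₁ n₂) n₃,
    primesOneModFour_mul n₁ n₂, primesOneModFour_mul n₂ n₃, primesOneModFour_mul n₁ n₃]
  rw [mul_assoc]
  have c₁₂ := characterProduct_of_primes₁₂ h he₁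
  have c₂₃ := characterProduct_of_primes₂₃ h he₁
  have c₁₃ := characterProduct_of_primes₁₃ h he₂
  by_cases p₁ : PrimesOneModFour D.D1 <;> by_cases p₂ : PrimesOneModFour D.D2 <;>
  by_cases p₃ : PrimesOneModFour D.D3 <;> simp only [p₁, p₂, p₃, forall_const] at c₁₂ c₂₃ c₁₃ <;>
  rcases he₁ with rfl | rfl <;> rcases he₂ with rfl | rfl <;>
  simp_all

end PsiTerms

/-! ### Evaluation of the divisor sum by inclusion-exclusion -/

section IndicatorFormula

variable {k D₁ D₂ D₃ : ℕ} {e₁ e₂ : ℤ}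

open Classical in
/-- The normalised sum of `characterProduct` over all factorizations. -/
theorem sum_characterProduct (h : OddSquarefreeData k D₁ D₂ D₃) {s : ℤ} (hs : s = 1 ∨ s = -1)
    (he₁ : e₁ = 1 ∨ e₁ = -1) (he₂ : e₂ = 1 ∨ e₂ = -1) :
    ∑ p ∈ D₁.divisorsAntidiagonal, ∑ q ∈ D₂.divisorsAntidiagonal,
      ∑ r ∈ D₃.divisorsAntidiagonal,
        (characterProduct k e₁ e₂ s ⟨p.1, p.2, q.1, q.2, r.1, r.2⟩ : ℚ) *
          (1 / 2 ^ DTuple.omega ⟨p.1, p.2, q.1, q.2, r.1, r.2⟩) =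
      if ResidueModPrimes (e₂ * k * D₂ * D₃) D₁ ∧ ResidueModPrimes (e₁ * k * D₁ * D₃) D₂ ∧
        ResidueModPrimes (s * (e₁ * e₂ * D₁ * D₂)) D₃ then 1 else 0 := by
  rw [← divisorSum_characters h (h.gcd_eq_one he₂) (h.swap.gcd_eq_one he₁)
    (h.gcd_eq_one' hs he₁ he₂)]
  refine Finset.sum_congr rfl fun p hp => Finset.sum_congr rfl fun q hq =>
    Finset.sum_congr rfl fun r hr => ?_
  rw [Nat.mem_divisorsAntidiagonal] at hp hq hr
  simp only [characterProduct, DTuple.D1, DTuple.D2, DTuple.D3, hp.1, hq.1, hr.1]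
  push_cast
  rfl

open Classical in
/-- The 2-adic factor is redundant for the main terms. -/
theorem archimedeanTwoAdicFactor_mul (h : OddSquarefreeData k D₁ D₂ D₃)
    (he₁ : e₁ = 1 ∨ e₁ = -1) (he₂ : e₂ = 1 ∨ e₂ = -1) :
    (archimedeanTwoAdicFactor k D₁ D₂ D₃ e₁ e₂ *
      if ResidueModPrimes (e₂ * k * D₂ * D₃) D₁ ∧ ResidueModPrimes (e₁ * k * D₁ * D₃) D₂ ∧
        ResidueModPrimes (-1 * (e₁ * e₂ * D₁ * D₂)) D₃ then 1 else 0) =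
      if TernaryIsotropic (e₁ * D₁) (e₂ * D₂) (-(k * D₃)) then 1 else 0 := by
  rw [neg_one_mul]
  by_cases hi : TernaryIsotropic (e₁ * D₁) (e₂ * D₂) (-(k * D₃))
  · have h2 : (eta (e₁ * D₁ * D₃) (e₂ * D₂ * D₃) : ℚ) * jacobiSym k (D₁ * D₂) = 1 := by
      exact_mod_cast eta_of_isotropic h he₁ he₂ hi
    obtain ⟨hs, hr⟩ := (isotropic_iff h he₁ he₂).mp hi
    rw [if_pos hi, if_pos hr, archimedeanTwoAdicFactor, if_pos hs, h2]
    norm_num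
  · rw [if_neg hi, archimedeanTwoAdicFactor]
    rw [isotropic_iff h he₁ he₂, not_and_or] at hi
    rcases hi with hi | hi
    · rw [if_neg hi, zero_mul, zero_mul]
    · rw [if_neg hi, mul_zero]

theorem odd_sign_mul {e : ℤ} (he : e = 1 ∨ e = -1) {a b : ℕ} (ha : Odd a) (hb : Odd b) :
    Odd (e * a * b) :=
  ((by rcases he with rfl | rfl <;> decide : Odd e).mul (by exact_mod_cast ha)).mul
    (by exact_mod_cast hb)

theorem neg_sign {e : ℤ} (he : e = 1 ∨ e = -1) : -e = 1 ∨ -e = -1 := by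
  rcases he with rfl | rfl <;> simp

theorem intCast_mul_mod_four {a b : ℕ} (ha : a % 4 = 1) (hb : b % 4 = 1) :
    (1 * a * b : ℤ) % 4 = 1 := by
  rw [one_mul, Int.mul_emod, show (a : ℤ) % 4 = 1 by omega, show (b : ℤ) % 4 = 1 by omega]
  rfl

/-- The two conics impose opposite residue conditions at `D₁` and at `D₂` and the same one at `D₃`.
The symbol `(k/D₁D₂)` is what remains of the 2-adic condition once `η` is trivial; it is recorded
because the weight contains the factor `½ (1 + (k/D₁D₂))`. -/
theorem isotropic_pair₁₂ (h : OddSquarefreeData k D₁ D₂ D₃) (he₁ : e₁ = 1 ∨ e₁ = -1)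
    (he₂ : e₂ = 1 ∨ e₂ = -1) :
    (TernaryIsotropic (-e₁ * D₁) (e₂ * D₂) (-(k * D₃)) ∧
      TernaryIsotropic (e₁ * D₁) (-e₂ * D₂) (-(k * D₃))) ↔
    ((e₁, e₂) ≠ (1, -1) ∧ (e₁, e₂) ≠ (-1, 1)) ∧ (PrimesOneModFour D₁ ∧ PrimesOneModFour D₂) ∧
      jacobiSym k (D₁ * D₂) = 1 ∧
      ResidueModPrimes (e₂ * k * D₂ * D₃) D₁ ∧ ResidueModPrimes (e₁ * k * D₁ * D₃) D₂ ∧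
        ResidueModPrimes (e₁ * e₂ * D₁ * D₂) D₃ := by
  have o₁ := h.odd₁
  have o₂ := h.rotate.odd₁
  have o₃ := h.rotate.rotate.odd₁
  constructor
  · rintro ⟨hi, hj⟩
    have ht := eta_of_isotropic h (neg_sign he₁) he₂ hi
    rw [isotropic_iff h (neg_sign he₁) he₂, pair_neg_ne_iff₁] at hi
    rw [isotropic_iff h he₁ (neg_sign he₂), pair_neg_ne_iff₂] at hj
    simp only [neg_mul, mul_neg, neg_neg] at hi hj
    obtain ⟨hi₀, hi₁, hi₂, hi₃⟩ := hi
    obtain ⟨hj₀, hj₁, hj₂, hj₃⟩ := hj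
    have p₁ := hi₁.primesOneModFour o₁ hj₁
    have p₂ := hj₂.primesOneModFour o₂ hi₂
    refine ⟨⟨hi₀, hj₀⟩, ⟨p₁, p₂⟩, ?_, hi₁, hj₂, hi₃⟩
    rwa [eta_eq_one_of_add (odd_sign_mul (neg_sign he₁) o₁ o₃) (odd_sign_mul he₂ o₂ o₃),
      one_mul] at ht
    -- The signs force `e₂ = e₁`, and the two arguments of `η` add up to `e₁ D₃ (D₂ - D₁)`, a
    -- multiple of `4`.
    have m₁ := p₁.mod_four o₁.pos.ne'
    have m₂ := p₂.mod_four o₂.pos.ne'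
    have hee : e₂ = e₁ := by
      rcases he₁ with rfl | rfl <;> rcases he₂ with rfl | rfl <;> simp_all
    rw [hee, show -e₁ * D₁ * D₃ + e₁ * D₂ * D₃ = (D₂ - D₁ : ℤ) * (e₁ * D₃) by ring,
      Int.mul_emod, show (D₂ - D₁ : ℤ) % 4 = 0 by omega]
    simp
  · rintro ⟨⟨hs, hs'⟩, ⟨p₁, p₂⟩, -, r₁, r₂, r₃⟩
    rw [isotropic_iff h (neg_sign he₁) he₂, pair_neg_ne_iff₁,
      isotropic_iff h he₁ (neg_sign he₂), pair_neg_ne_iff₂]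
    simp only [neg_mul, mul_neg, neg_neg]
    exact ⟨⟨hs, r₁, (residueModPrimes_neg_iff o₂ p₂).mpr r₂, r₃⟩,
      ⟨hs', (residueModPrimes_neg_iff o₁ p₁).mpr r₁, r₂, r₃⟩⟩

/-- Here the opposite conditions occur at `D₂` and `D₃`. The signs force `e₂ = 1`, so the second
argument of `η` is `D₂ D₃ ≡ 1` mod `4`. -/
theorem isotropic_pair₂₃ (h : OddSquarefreeData k D₁ D₂ D₃) (he₁ : e₁ = 1 ∨ e₁ = -1)
    (he₂ : e₂ = 1 ∨ e₂ = -1) :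
    (TernaryIsotropic (-e₁ * D₁) (e₂ * D₂) (-(k * D₃)) ∧
      TernaryIsotropic (e₁ * D₁) (e₂ * D₂) (-(k * D₃))) ↔
    ((e₁, e₂) ≠ (1, -1) ∧ (e₁, e₂) ≠ (-1, -1)) ∧ (PrimesOneModFour D₂ ∧ PrimesOneModFour D₃) ∧
      jacobiSym k (D₁ * D₂) = 1 ∧
      ResidueModPrimes (e₂ * k * D₂ * D₃) D₁ ∧ ResidueModPrimes (e₁ * k * D₁ * D₃) D₂ ∧
        ResidueModPrimes (e₁ * e₂ * D₁ * D₂) D₃ := by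
  have o₁ := h.odd₁
  have o₂ := h.rotate.odd₁
  have o₃ := h.rotate.rotate.odd₁
  constructor
  · rintro ⟨hi, hj⟩
    have ht := eta_of_isotropic h he₁ he₂ hj
    rw [isotropic_iff h (neg_sign he₁) he₂, pair_neg_ne_iff₁] at hi
    rw [isotropic_iff h he₁ he₂] at hj
    simp only [neg_mul, neg_neg] at hi
    obtain ⟨hi₀, hi₁, hi₂, hi₃⟩ := hi
    obtain ⟨hj₀, hj₁, hj₂, hj₃⟩ := hj
    have p₂ := hj₂.primesOneModFour o₂ hi₂
    have p₃ := hi₃.primesOneModFour o₃ hj₃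
    refine ⟨⟨hi₀, hj₀⟩, ⟨p₂, p₃⟩, ?_, hi₁, hj₂, hi₃⟩
    rwa [eta_eq_one_of_right (odd_sign_mul he₁ o₁ o₃), one_mul] at ht
    have hee : e₂ = 1 := by
      rcases he₁ with rfl | rfl <;> rcases he₂ with rfl | rfl <;> simp_all
    rw [hee]
    exact intCast_mul_mod_four (p₂.mod_four o₂.pos.ne') (p₃.mod_four o₃.pos.ne')
  · rintro ⟨⟨hs, hs'⟩, ⟨p₂, p₃⟩, -, r₁, r₂, r₃⟩
    rw [isotropic_iff h (neg_sign he₁) he₂, pair_neg_ne_iff₁, isotropic_iff h he₁ he₂]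
    simp only [neg_mul, neg_neg]
    exact ⟨⟨hs, r₁, (residueModPrimes_neg_iff o₂ p₂).mpr r₂, r₃⟩,
      ⟨hs', r₁, r₂, (residueModPrimes_neg_iff o₃ p₃).mpr r₃⟩⟩

theorem isotropic_pair₁₃ (h : OddSquarefreeData k D₁ D₂ D₃) (he₁ : e₁ = 1 ∨ e₁ = -1)
    (he₂ : e₂ = 1 ∨ e₂ = -1) :
    (TernaryIsotropic (e₁ * D₁) (-e₂ * D₂) (-(k * D₃)) ∧
      TernaryIsotropic (e₁ * D₁) (e₂ * D₂) (-(k * D₃))) ↔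
    ((e₁, e₂) ≠ (-1, 1) ∧ (e₁, e₂) ≠ (-1, -1)) ∧ (PrimesOneModFour D₁ ∧ PrimesOneModFour D₃) ∧
      jacobiSym k (D₁ * D₂) = 1 ∧
      ResidueModPrimes (e₂ * k * D₂ * D₃) D₁ ∧ ResidueModPrimes (e₁ * k * D₁ * D₃) D₂ ∧
        ResidueModPrimes (e₁ * e₂ * D₁ * D₂) D₃ := by
  have hsw : ∀ {a b c : ℤ}, TernaryIsotropic a b c ↔ TernaryIsotropic b a c :=
    ⟨fun h => h.swap, fun h => h.swap⟩
  rw [hsw, hsw (a := e₁ * D₁), isotropic_pair₂₃ h.swap he₂ he₁]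
  rw [mul_comm D₂ D₁, mul_comm e₂ e₁, mul_right_comm (e₁ * e₂)]
  simp only [ne_eq, Prod.mk.injEq]
  tauto

/-- For a sign `K`, `½ (1 + K)` is the indicator of `K = 1`, so the left side is the indicator of a
conjunction. -/
theorem ite_product_eq {u q P S : Prop} [Decidable u] [Decidable q] [Decidable P] [Decidable S]
    {K : ℤ} (hK : K = 1 ∨ K = -1) (h : S ↔ u ∧ q ∧ K = 1 ∧ P) :
    (if u then (1 : ℚ) else 0) * (if q then 1 else 0) * (1 / 2 * (1 + K)) *
      (if P then 1 else 0) = if S then 1 else 0 := by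
  rw [if_congr h rfl rfl]
  rcases hK with rfl | rfl <;> by_cases hu : u <;> by_cases hq : q <;> by_cases hP : P <;>
    simp [hu, hq, hP]
  norm_num

open Classical in
/-- The value of the divisor sum with weight `F_odd` (`k = 1`) or `F_even` (`k = 2`). -/
theorem divisorSum_weight (h : OddSquarefreeData k D₁ D₂ D₃) (he₁ : e₁ = 1 ∨ e₁ = -1)
    (he₂ : e₂ = 1 ∨ e₂ = -1) :
    divisorSum D₁ D₂ D₃ (DTuple.weight k e₁ e₂) =
      if TernaryIsotropic (e₁ * D₁) (e₂ * D₂) (-(k * D₃)) ∨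
        TernaryIsotropic (-e₁ * D₁) (e₂ * D₂) (-(k * D₃)) ∨
        TernaryIsotropic (e₁ * D₁) (-e₂ * D₂) (-(k * D₃)) then 1 else 0 := by
  have n₁ := h.odd₁.pos.ne'
  have n₂ := h.rotate.odd₁.pos.ne'
  have n₃ := h.rotate.rotate.odd₁.pos.ne'
  -- The `ψ`-combination depends only on `D₁`, `D₂`, `D₃`, so it may be read off at the trivial
  -- factorization and pulled out of the sum.
  set C : ℚ := DTuple.psiTerms e₁ e₂ ⟨1, D₁, 1, D₂, 1, D₃⟩ *
    (1 / 2 * (1 + jacobiSym k (D₁ * D₂))) with hC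
  have hterm : ∀ p ∈ D₁.divisorsAntidiagonal, ∀ q ∈ D₂.divisorsAntidiagonal,
      ∀ r ∈ D₃.divisorsAntidiagonal, ∀ t : ℚ,
        DTuple.weight k e₁ e₂ ⟨p.1, p.2, q.1, q.2, r.1, r.2⟩ * t *
          DTuple.g ⟨p.1, p.2, q.1, q.2, r.1, r.2⟩ =
        archimedeanTwoAdicFactor k D₁ D₂ D₃ (-e₁) e₂ *
          (characterProduct k (-e₁) e₂ (-1) ⟨p.1, p.2, q.1, q.2, r.1, r.2⟩ * t) +
        archimedeanTwoAdicFactor k D₁ D₂ D₃ e₁ (-e₂) *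
          (characterProduct k e₁ (-e₂) (-1) ⟨p.1, p.2, q.1, q.2, r.1, r.2⟩ * t) +
        archimedeanTwoAdicFactor k D₁ D₂ D₃ e₁ e₂ *
          (characterProduct k e₁ e₂ (-1) ⟨p.1, p.2, q.1, q.2, r.1, r.2⟩ * t) +
        C * (characterProduct k e₁ e₂ 1 ⟨p.1, p.2, q.1, q.2, r.1, r.2⟩ * t) := by
    intro p hp q hq r hr t
    rw [Nat.mem_divisorsAntidiagonal] at hp hq hr
    generalize hD : DTuple.mk p.1 p.2 q.1 q.2 r.1 r.2 = D
    have h1 : D.D1 = D₁ := by rw [← hD]; exact hp.1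
    have h2 : D.D2 = D₂ := by rw [← hD]; exact hq.1
    have h3 : D.D3 = D₃ := by rw [← hD]; exact hr.1
    have hd : OddSquarefreeData k D.D1 D.D2 D.D3 := by rwa [h1, h2, h3]
    have a1 := reciprocityTerms_mul_g hd he₁ he₂
    have a2 := psiTerms_mul_g hd he₁ he₂
    have a3 : D.psiTerms e₁ e₂ = DTuple.psiTerms e₁ e₂ ⟨1, D₁, 1, D₂, 1, D₃⟩ := by
      simp only [DTuple.psiTerms, h1, h2, h3]
      simp only [DTuple.D1, DTuple.D2, DTuple.D3, one_mul]
    rw [DTuple.weight, hC, ← a3]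
    rw [h1, h2, h3] at a1
    rw [h1, h2]
    linear_combination t * a1 + t * (1 / 2 * (1 + jacobiSym k (D₁ * D₂))) * a2
  -- Summation turns each main part into the indicator of one conic; the `ψ`-part keeps the residue
  -- conditions with `s = 1`, common to all intersections.
  have hsum : divisorSum D₁ D₂ D₃ (DTuple.weight k e₁ e₂) =
      (if TernaryIsotropic (-e₁ * D₁) (e₂ * D₂) (-(k * D₃)) then 1 else 0) +
      (if TernaryIsotropic (e₁ * D₁) (-e₂ * D₂) (-(k * D₃)) then 1 else 0) +
      (if TernaryIsotropic (e₁ * D₁) (e₂ * D₂) (-(k * D₃)) then 1 else 0) +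
      C * (if ResidueModPrimes (e₂ * k * D₂ * D₃) D₁ ∧ ResidueModPrimes (e₁ * k * D₁ * D₃) D₂ ∧
        ResidueModPrimes (e₁ * e₂ * D₁ * D₂) D₃ then 1 else 0) := by
    rw [← archimedeanTwoAdicFactor_mul h (neg_sign he₁) he₂,
      ← archimedeanTwoAdicFactor_mul h he₁ (neg_sign he₂),
      ← archimedeanTwoAdicFactor_mul h he₁ he₂,
      ← sum_characterProduct h (Or.inr rfl) (neg_sign he₁) he₂,
      ← sum_characterProduct h (Or.inr rfl) he₁ (neg_sign he₂),
      ← sum_characterProduct h (Or.inr rfl) he₁ he₂]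
    have h1 := sum_characterProduct h (Or.inl rfl) he₁ he₂
    rw [one_mul] at h1
    rw [← h1, divisorSum]
    simp only [Finset.mul_sum, ← Finset.sum_add_distrib]
    exact Finset.sum_congr rfl fun p hp => Finset.sum_congr rfl fun q hq =>
      Finset.sum_congr rfl fun r hr => hterm p hp q hq r hr _
  have i₁₂ := isotropic_pair₁₂ h he₁ he₂
  have i₂₃ := isotropic_pair₂₃ h he₁ he₂
  have i₁₃ := isotropic_pair₁₃ h he₁ he₂
  rw [hsum, hC, DTuple.psiTerms]
  simp only [DTuple.D1, DTuple.D2, DTuple.D3, one_mul, psiOneModFour_eq,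
    primesOneModFour_mul (mul_ne_zero n₁ n₂) n₃, primesOneModFour_mul n₁ n₂,
    primesOneModFour_mul n₂ n₃, primesOneModFour_mul n₁ n₃]
  have hK : jacobiSym k (D₁ * D₂) = 1 ∨ jacobiSym k (D₁ * D₂) = -1 := by
    refine jacobiSym.eq_one_or_neg_one ?_
    rw [Int.gcd_natCast_natCast]
    rcases h.factor with rfl | rfl
    · exact Nat.coprime_one_left _
    · exact Nat.coprime_two_left.mpr (h.odd₁.mul h.rotate.odd₁)
  have hone : (e₁, e₂) = (1, 1) ↔ ((e₁, e₂) ≠ (1, -1) ∧ (e₁, e₂) ≠ (-1, 1)) ∧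
      (e₁, e₂) ≠ (-1, -1) := by
    rcases he₁ with rfl | rfl <;> rcases he₂ with rfl | rfl <;> simp
  have t₁₂ := ite_product_eq hK i₁₂
  have t₂₃ := ite_product_eq hK i₂₃
  have t₁₃ := ite_product_eq hK i₁₃
  -- The triple intersection combines the pairs `₁₂` and `₂₃`: all primes are `1` mod `4` and both
  -- signs are positive.
  have t₁₂₃ := ite_product_eq (u := (e₁, e₂) = (1, 1))
    (q := (PrimesOneModFour D₁ ∧ PrimesOneModFour D₂) ∧ PrimesOneModFour D₃) hK
    (S := (TernaryIsotropic (-e₁ * D₁) (e₂ * D₂) (-(k * D₃)) ∧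
      TernaryIsotropic (e₁ * D₁) (-e₂ * D₂) (-(k * D₃))) ∧
      TernaryIsotropic (e₁ * D₁) (e₂ * D₂) (-(k * D₃)))
    (P := ResidueModPrimes (e₂ * k * D₂ * D₃) D₁ ∧ ResidueModPrimes (e₁ * k * D₁ * D₃) D₂ ∧
        ResidueModPrimes (e₁ * e₂ * D₁ * D₂) D₃) (by
      rw [hone]
      constructor
      · rintro ⟨⟨h₁, h₂⟩, h₃⟩
        obtain ⟨hu, hq, hk1, hP⟩ := i₁₂.mp ⟨h₁, h₂⟩
        obtain ⟨hu', hq', -, -⟩ := i₂₃.mp ⟨h₁, h₃⟩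
        exact ⟨⟨hu, hu'.2⟩, ⟨hq, hq'.2⟩, hk1, hP⟩
      · rintro ⟨⟨hu, hu'⟩, ⟨hq, hq'⟩, hk1, hP⟩
        exact ⟨i₁₂.mpr ⟨hu, hq, hk1, hP⟩,
          (i₂₃.mpr ⟨⟨hu.1, hu'⟩, ⟨hq.2, hq'⟩, hk1, hP⟩).2⟩)
  have hincl : ∀ S₁ S₂ S₃ : Prop, (if S₁ then (1 : ℚ) else 0) + (if S₂ then 1 else 0) +
      (if S₃ then 1 else 0) - (if S₁ ∧ S₂ then 1 else 0) - (if S₁ ∧ S₃ then 1 else 0) -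
      (if S₂ ∧ S₃ then 1 else 0) + (if (S₁ ∧ S₂) ∧ S₃ then 1 else 0) =
      if S₃ ∨ S₁ ∨ S₂ then 1 else 0 := by
    intro S₁ S₂ S₃
    by_cases h₁ : S₁ <;> by_cases h₂ : S₂ <;> by_cases h₃ : S₃ <;> simp [h₁, h₂, h₃]
  rw [← hincl]
  linear_combination -t₁₂ - t₂₃ - t₁₃ + t₁₂₃

end IndicatorFormula

/-! ### Dihedral Galois groups and conics -/

/-- A group generated by an element `σ` of order `4` and an involution inverting it is dihedral
of order `8`. -/
theorem nonempty_mulEquiv_dihedralGroup_four {G : Type*} [Group G] {σ τ : G} (hσ : σ ^ 4 = 1)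
    (hσ2 : σ ^ 2 ≠ 1) (hτ : τ * τ = 1) (hrel : σ * τ = τ * σ⁻¹)
    (hgen : ∀ g : G, ∃ n : ℕ, g = σ ^ n ∨ g = τ * σ ^ n) :
    Nonempty (G ≃* DihedralGroup 4) := by
  have hmod : ∀ n : ℕ, σ ^ (n % 4) = σ ^ n := fun n => by
    conv_rhs => rw [← Nat.mod_add_div n 4, pow_add, pow_mul, hσ, one_pow, mul_one]
  have hinv : ∀ n : ℕ, σ ^ n * τ = τ * (σ ^ n)⁻¹ := by
    intro n
    induction n with
    | zero => simp
    | succ n ih => rw [pow_succ, mul_assoc, hrel, ← mul_assoc, ih, mul_assoc, ← mul_inv_rev,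
        ← pow_succ', pow_succ]
  have hadd : ∀ i j : ZMod 4, σ ^ i.val * σ ^ j.val = σ ^ (i + j).val := fun i j => by
    rw [ZMod.val_add, hmod, pow_add]
  have hsub : ∀ i j : ZMod 4, (σ ^ i.val)⁻¹ * σ ^ j.val = σ ^ (j - i).val := fun i j => by
    rw [inv_mul_eq_iff_eq_mul, hadd, add_sub_cancel]
  let f : DihedralGroup 4 → G := fun d => match d with
    | .r i => σ ^ i.val
    | .sr i => τ * σ ^ i.val
  have hmul : ∀ a b, f (a * b) = f a * f b := by
    rintro (i | i) (j | j)
    · exact (hadd i j).symm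
    · change τ * σ ^ (j - i).val = σ ^ i.val * (τ * σ ^ j.val)
      rw [← mul_assoc, hinv, mul_assoc, hsub]
    · change τ * σ ^ (i + j).val = τ * σ ^ i.val * σ ^ j.val
      rw [mul_assoc, hadd]
    · change σ ^ (j - i).val = τ * σ ^ i.val * (τ * σ ^ j.val)
      rw [mul_assoc, ← mul_assoc (σ ^ i.val), hinv, mul_assoc, ← mul_assoc, hτ, one_mul, hsub]
  let F : DihedralGroup 4 →* G := MonoidHom.mk' f hmul
  have hinj : Function.Injective F := by
    rw [injective_iff_map_eq_one]
    rintro (i | i) hi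
    · change σ ^ i.val = 1 at hi
      -- For `i ≠ 0`, either `i` or `2i` equals `2`, so `σ ^ i = 1` would give `σ² = 1`.
      have h2 : ∀ i : ZMod 4, i = 0 ∨ i.val = 2 ∨ (i + i).val = 2 := by decide
      rcases h2 i with h | h | h
      · rw [h]; rfl
      · exact absurd (h ▸ hi) hσ2
      · refine absurd ?_ hσ2
        rw [← h, ← hadd, hi, mul_one]
    · exfalso
      change τ * σ ^ i.val = 1 at hi
      -- Otherwise `τ` would be a power of `σ` and commute with it, and the inversion relation would
      -- give `σ = σ⁻¹`.
      have hcomm : σ * τ = τ * σ := by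
        rw [eq_inv_of_mul_eq_one_left hi]
        exact ((Commute.refl σ).pow_right _).inv_right
      rw [hrel] at hcomm
      refine hσ2 ?_
      rw [sq]
      nth_rewrite 1 [← mul_left_cancel hcomm]
      exact inv_mul_cancel σ
  have hsurj : Function.Surjective F := by
    intro g
    obtain ⟨n, hn | hn⟩ := hgen g
    · refine ⟨.r n, ?_⟩
      change σ ^ (n : ZMod 4).val = g
      rw [ZMod.val_natCast, hmod, hn]
    · refine ⟨.sr n, ?_⟩
      change τ * σ ^ (n : ZMod 4).val = g
      rw [ZMod.val_natCast, hmod, hn]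
  exact ⟨(MulEquiv.ofBijective F ⟨hinj, hsurj⟩).symm⟩

section Galois

variable {F : Type*} [Field F] [Algebra ℚ F]

theorem algEquiv_apply_sqrt {a : F} {d : ℚ} (ha : a ^ 2 = algebraMap ℚ F d) (g : F ≃ₐ[ℚ] F) :
    g a = a ∨ g a = -a := by
  rw [← sq_eq_sq_iff_eq_or_eq_neg, ← map_pow, ha, AlgEquiv.commutes]

theorem ne_zero_of_sq_eq_nonsquare {a : F} {d : ℚ} (ha : a ^ 2 = algebraMap ℚ F d)
    (hd : ¬ IsSquare d) : a ≠ 0 := by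
  rintro rfl
  refine hd ⟨0, ?_⟩
  have : algebraMap ℚ F d = algebraMap ℚ F 0 := by rw [← ha]; simp
  simpa using (algebraMap ℚ F).injective this

/-- In an extension generated dihedrally by `r` and `s`, the square roots `a` and `b` on
which `(r, s)` act by `(-, +)` and `(-, -)` come from a solvable conic. -/
theorem conic_of_dihedral {d₁ d₂ : ℚ} {r s : F ≃ₐ[ℚ] F} (hr : r ^ 4 = 1) (hr2 : r ^ 2 ≠ 1)
    (hs : s * s = 1) (hsr : s * r = r ^ 3 * s) (hs1 : s ≠ 1) (hsr2 : s ≠ r ^ 2)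
    (hfix : ∀ w : F, r w = w → s w = w → w ∈ Set.range (algebraMap ℚ F))
    {a b : F} (ha : a ^ 2 = algebraMap ℚ F d₁) (hb : b ^ 2 = algebraMap ℚ F d₂)
    (ha0 : a ≠ 0) (hb0 : b ≠ 0) (hra : r a = -a) (hsa : s a = a) (hrb : r b = -b)
    (hsb : s b = -b) : ∃ x y z : ℚ, y ≠ 0 ∧ z ^ 2 = d₁ * x ^ 2 + d₂ * y ^ 2 := by
  have : CharZero F := algebraRat.charZero F
  have r4 : ∀ w, r (r (r (r w))) = w := fun w => by
    simpa [pow_succ] using DFunLike.congr_fun hr w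
  have s2 : ∀ w, s (s w) = w := fun w => DFunLike.congr_fun hs w
  have sr : ∀ w, s (r w) = r (r (r (s w))) := fun w => by
    simpa [pow_succ] using DFunLike.congr_fun hsr w
  -- The operator `1 + s - r² - s r²` projects, up to a scalar, onto elements fixed by `s` and
  -- negated by `r²`. It is not zero because distinct automorphisms are linearly independent.
  obtain ⟨ξ, hξ⟩ : ∃ ξ : F, ξ + s ξ - r (r ξ) - s (r (r ξ)) ≠ 0 := by
    by_contra! hcon
    have hr22 : r ^ 2 * r ^ 2 = 1 := by rw [← pow_add]; exact hr
    have hsr2' : s * r ^ 2 ≠ 1 := fun h => hsr2 (by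
      rw [← mul_one s, ← hr22, ← mul_assoc, h, one_mul])
    have hinj : Function.Injective
        (fun i => ((![1, s, r ^ 2, s * r ^ 2] i : F ≃ₐ[ℚ] F) : F →ₐ[ℚ] F)) := by
      refine (AlgEquiv.coe_toAlgHom_injective).comp (f := ![1, s, r ^ 2, s * r ^ 2]) ?_
      intro i j hij
      fin_cases i <;> fin_cases j <;> simp at hij ⊢ <;>
        first
        | exact hs1 hij | exact hs1 hij.symm | exact hr2 hij | exact hr2 hij.symm
        | exact hsr2 hij | exact hsr2 hij.symm | exact hsr2' hij | exact hsr2' hij.symm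
    have hli := Fintype.linearIndependent_iff.mp
      ((linearIndependent_toLinearMap ℚ F F).comp _ hinj) ![1, 1, -1, -1] (by
        ext w
        have := hcon w
        simp [Fin.sum_univ_four, sq]
        linear_combination this) 0
    exact one_ne_zero hli
  set θ := ξ + s ξ - r (r ξ) - s (r (r ξ)) with hθ
  have sθ : s θ = θ := by
    simp only [hθ, map_sub, map_add, s2]; ring
  have rrθ : r (r θ) = -θ := by
    have h1 : ∀ w, r (r (s w)) = s (r (r w)) := fun w => by rw [sr, sr, r4]
    simp only [hθ, map_sub, map_add, h1, r4]
    ring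
  have srθ : s (r θ) = -r θ := by rw [sr, sθ, rrθ, map_neg]
  -- With `ρ = r θ`, the elements `y = θρ/b`, `z = (θ² + ρ²)/2` and `x = (θ² - ρ²)/(2a)` are
  -- invariant, hence rational, and `z² - a² x² = θ² ρ² = b² y²`.
  obtain ⟨y, hy⟩ := hfix (θ * r θ / b)
    (by rw [map_div₀, map_mul, rrθ, hrb]; field_simp)
    (by rw [map_div₀, map_mul, srθ, sθ, hsb]; field_simp)
  obtain ⟨z, hz⟩ := hfix ((θ ^ 2 + (r θ) ^ 2) / 2)
    (by simp only [map_div₀, map_add, map_pow, rrθ, map_ofNat]; ring)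
    (by simp only [map_div₀, map_add, map_pow, srθ, sθ, map_ofNat]; ring)
  obtain ⟨x, hx⟩ := hfix ((θ ^ 2 - (r θ) ^ 2) / (2 * a))
    (by simp only [map_div₀, map_sub, map_mul, map_pow, rrθ, hra, map_ofNat]; field_simp; ring)
    (by simp only [map_div₀, map_sub, map_mul, map_pow, srθ, sθ, hsa, map_ofNat, neg_sq])
  refine ⟨x, y, z, ?_, (algebraMap ℚ F).injective ?_⟩
  · rintro rfl
    rw [map_zero, eq_comm, div_eq_zero_iff] at hy
    simp [hξ, hb0] at hy
  · simp only [map_add, map_mul, map_pow, hx, hy, hz, ← ha, ← hb]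
    field_simp
    ring

variable [FiniteDimensional ℚ F] [IsGalois ℚ F]

theorem exists_algEquiv_sqrt_eq_neg {a : F} {d : ℚ} (ha : a ^ 2 = algebraMap ℚ F d)
    (hd : ¬ IsSquare d) : ∃ g : F ≃ₐ[ℚ] F, g a = -a := by
  by_contra! hcon
  have hfix : ∀ g : F ≃ₐ[ℚ] F, g a = a := fun g =>
    (algEquiv_apply_sqrt ha g).resolve_right (hcon g)
  obtain ⟨c, rfl⟩ := (IsGalois.mem_range_algebraMap_iff_fixed a).mpr hfix
  rw [← map_pow] at ha
  exact hd ⟨c, by rw [← sq]; exact ((algebraMap ℚ F).injective ha).symm⟩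

/-- The Galois group of `ℚ(√d₁, √d₂, √(z + x √d₁))`, where `z² = d₁ x² + d₂ y²`, is dihedral. -/
theorem nonempty_galois_mulEquiv_dihedralGroup {d₁ d₂ x y z : ℚ} (h₁ : ¬ IsSquare d₁)
    (h₂ : ¬ IsSquare d₂) (h₁₂ : ¬ IsSquare (d₁ * d₂)) (hxyz : z ^ 2 = d₁ * x ^ 2 + d₂ * y ^ 2)
    (hy : y ≠ 0) {a b t : F} (ha : a ^ 2 = algebraMap ℚ F d₁) (hb : b ^ 2 = algebraMap ℚ F d₂)
    (ht : t ^ 2 = algebraMap ℚ F z + algebraMap ℚ F x * a)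
    (hgen : ∀ g h : F ≃ₐ[ℚ] F, g t = h t → g b = h b → g = h) :
    Nonempty ((F ≃ₐ[ℚ] F) ≃* DihedralGroup 4) := by
  have a0 := ne_zero_of_sq_eq_nonsquare ha h₁
  have b0 := ne_zero_of_sq_eq_nonsquare hb h₂
  have hab : (a * b) ^ 2 = algebraMap ℚ F (d₁ * d₂) := by rw [mul_pow, ha, hb, map_mul]
  have : CharZero F := algebraRat.charZero F
  have hneg : ∀ {w : F}, w ≠ 0 → w ≠ -w := fun {w} hw h => hw (self_eq_neg.mp h)
  have hy' : algebraMap ℚ F y ≠ 0 := by simpa using hy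
  have hnorm : (algebraMap ℚ F z + algebraMap ℚ F x * a) *
      (algebraMap ℚ F z - algebraMap ℚ F x * a) = (algebraMap ℚ F y * b) ^ 2 := by
    have := congrArg (algebraMap ℚ F) hxyz
    simp only [map_add, map_mul, map_pow] at this
    linear_combination this - (algebraMap ℚ F x) ^ 2 * ha - (algebraMap ℚ F y) ^ 2 * hb
  have t0 : t ≠ 0 := by
    rintro rfl
    rw [← ht] at hnorm
    have : (algebraMap ℚ F y * b) ^ 2 ≠ 0 := pow_ne_zero 2 (mul_ne_zero hy' b0)
    exact this (by rw [← hnorm]; ring)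
  obtain ⟨g₁, hg₁⟩ := exists_algEquiv_sqrt_eq_neg ha h₁
  obtain ⟨g₂, hg₂⟩ := exists_algEquiv_sqrt_eq_neg hb h₂
  obtain ⟨g₃, hg₃⟩ := exists_algEquiv_sqrt_eq_neg hab h₁₂
  obtain ⟨σ, hσa, hσb⟩ : ∃ σ : F ≃ₐ[ℚ] F, σ a = -a ∧ σ b = -b := by
    rcases algEquiv_apply_sqrt hb g₁ with h | h
    · rcases algEquiv_apply_sqrt ha g₂ with h' | h'
      · exact ⟨g₁ * g₂, by simp [h', hg₁], by simp [hg₂, h]⟩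
      · exact ⟨g₂, h', hg₂⟩
    · exact ⟨g₁, hg₁, h⟩
  -- An automorphism negating `ab` negates exactly one of `a`, `b`. If that one is `a`, composition
  -- with `σ` corrects it.
  obtain ⟨τ, hτa, hτb⟩ : ∃ τ : F ≃ₐ[ℚ] F, τ a = a ∧ τ b = -b := by
    rw [map_mul] at hg₃
    rcases algEquiv_apply_sqrt ha g₃ with h | h
    · refine ⟨g₃, h, mul_left_cancel₀ a0 ?_⟩
      rw [h] at hg₃
      rw [hg₃, mul_neg]
    · have hb3 : g₃ b = b := by
        refine mul_left_cancel₀ (neg_ne_zero.mpr a0) ?_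
        rw [h] at hg₃
        rw [hg₃, neg_mul]
      exact ⟨g₃ * σ, by simp [hσa, h], by simp [hσb, hb3]⟩
  have hfix : ∀ g : F ≃ₐ[ℚ] F, g a = a → g t = t ∨ g t = -t := fun g hg => by
    rw [← sq_eq_sq_iff_eq_or_eq_neg, ← map_pow, ht]
    simp [hg]
  -- `(σ t · t)²` is the norm of `z + x a`, that is `(y b)²`. As `σ b = -b`, applying `σ` to `c b /
  -- t` gives `σ² t = -t`, so `σ` has order `4`.
  have hσt : ∃ c : ℚ, c ≠ 0 ∧ σ t = algebraMap ℚ F c * b / t := by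
    have hsq : (σ t * t) ^ 2 = (algebraMap ℚ F y * b) ^ 2 := by
      rw [mul_pow, ← map_pow, ht, ← hnorm]
      simp only [map_add, map_mul, AlgEquiv.commutes, hσa]
      ring
    rcases sq_eq_sq_iff_eq_or_eq_neg.mp hsq with h | h
    · exact ⟨y, hy, by rw [← h]; field_simp⟩
    · exact ⟨-y, neg_ne_zero.mpr hy, by rw [map_neg, neg_mul, ← h]; field_simp⟩
  obtain ⟨c, hc, hσt⟩ := hσt
  have hc' : algebraMap ℚ F c ≠ 0 := by simpa using hc
  have hσσt : σ (σ t) = -t := by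
    rw [hσt]
    simp only [map_div₀, map_mul, AlgEquiv.commutes, hσb, hσt]
    field_simp
  have hσσb : σ (σ b) = b := by rw [hσb, map_neg, hσb, neg_neg]
  have hττt : τ (τ t) = t := by
    rcases hfix τ hτa with h | h
    · rw [h, h]
    · rw [h, map_neg, h, neg_neg]
  have hττb : τ (τ b) = b := by rw [hτb, map_neg, hτb, neg_neg]
  have hσ4 : σ ^ 4 = 1 := hgen _ _
    (by simp [pow_succ, hσσt])
    (by simp [pow_succ, hσσb])
  refine nonempty_mulEquiv_dihedralGroup_four (σ := σ) (τ := τ) hσ4 ?_ ?_ ?_ ?_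
  · intro h
    have := congrArg (fun g : F ≃ₐ[ℚ] F => g t) h
    simp only [sq, AlgEquiv.mul_apply, hσσt, AlgEquiv.one_apply] at this
    exact hneg t0 this.symm
  · exact hgen _ _ (by simpa using hττt) (by simpa using hττb)
  · have hinv : σ⁻¹ = σ * σ ^ 2 := by
      rw [inv_eq_iff_mul_eq_one, ← pow_succ', ← pow_succ', hσ4]
    rw [hinv]
    refine hgen _ _ ?_ ?_
    · simp only [sq, AlgEquiv.mul_apply, hσσt, map_neg]
      rw [hσt]
      rcases hfix τ hτa with h | h
      · simp only [h, hσt, map_div₀, map_mul, AlgEquiv.commutes, hτb]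
        ring
      · simp only [h, map_neg, hσt, map_div₀, map_mul, AlgEquiv.commutes, hτb]
        field_simp
    · simp only [sq, AlgEquiv.mul_apply, hσb, hτb, map_neg, neg_neg]
  -- The signs of `g` on `a` and `b` determine `g` up to `σ²`, and `1`, `τ`, `τσ`, `σ` realise the
  -- four sign patterns.
  · have hone : ∀ g : F ≃ₐ[ℚ] F, g a = a → g b = b → g = 1 ∨ g = σ ^ 2 := by
      intro g hga hgb
      rcases hfix g hga with h | h
      · exact Or.inl (hgen _ _ (by simpa using h) (by simpa using hgb))
      · refine Or.inr (hgen _ _ ?_ ?_)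
        · simp only [sq, AlgEquiv.mul_apply, hσσt, h]
        · simp only [sq, AlgEquiv.mul_apply, hσσb, hgb]
    have hred : ∀ g h : F ≃ₐ[ℚ] F, g a = h a → g b = h b → g = h ∨ g = h * σ ^ 2 := by
      intro g h hga hgb
      rcases hone (h⁻¹ * g) (by simp [hga]) (by simp [hgb]) with h' | h'
      · exact Or.inl (inv_mul_eq_one.mp h').symm
      · exact Or.inr (inv_mul_eq_iff_eq_mul.mp h')
    intro g
    rcases algEquiv_apply_sqrt ha g with hga | hga <;>
      rcases algEquiv_apply_sqrt hb g with hgb | hgb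
    · rcases hred g 1 hga hgb with h | h
      · exact ⟨0, Or.inl (by simpa using h)⟩
      · exact ⟨2, Or.inl (by simpa using h)⟩
    · rcases hred g τ (by rw [hga, hτa]) (by rw [hgb, hτb]) with h | h
      · exact ⟨0, Or.inr (by simpa using h)⟩
      · exact ⟨2, Or.inr h⟩
    · rcases hred g (τ * σ) (by simp [hga, hσa, hτa]) (by simp [hgb, hσb, hτb]) with h | h
      · exact ⟨1, Or.inr (by simpa using h)⟩
      · exact ⟨3, Or.inr (by rw [h, mul_assoc, pow_succ' σ 2])⟩
    · rcases hred g σ (by rw [hga, hσa]) (by rw [hgb, hσb]) with h | h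
      · exact ⟨1, Or.inl (by simpa using h)⟩
      · exact ⟨3, Or.inl (by rw [h, pow_succ' σ 2])⟩

end Galois

/-! ### The `D₄`-criterion for biquadratic fields -/

/-- Three nonsquare integers whose product is a nonzero square, in a form symmetric up to
rational squares. -/
structure BiquadraticTriple (d₁ d₂ d₃ : ℤ) : Prop where
  nonsquare₁ : ¬ IsSquare (d₁ : ℚ)
  nonsquare₂ : ¬ IsSquare (d₂ : ℚ)
  nonsquare₃ : ¬ IsSquare (d₃ : ℚ)
  rel : ∃ q : ℚ, q ≠ 0 ∧ d₃ * q ^ 2 = d₁ * d₂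

namespace BiquadraticTriple

variable {d₁ d₂ d₃ : ℤ}

theorem ne_zero₁ (h : BiquadraticTriple d₁ d₂ d₃) : (d₁ : ℚ) ≠ 0 := fun h0 =>
  h.nonsquare₁ ⟨0, by simpa using h0⟩

theorem swap (h : BiquadraticTriple d₁ d₂ d₃) : BiquadraticTriple d₂ d₁ d₃ := by
  obtain ⟨q, hq, hr⟩ := h.rel
  exact ⟨h.nonsquare₂, h.nonsquare₁, h.nonsquare₃, q, hq, by rw [hr, mul_comm]⟩

theorem swap₂₃ (h : BiquadraticTriple d₁ d₂ d₃) : BiquadraticTriple d₁ d₃ d₂ := by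
  obtain ⟨q, hq, hr⟩ := h.rel
  refine ⟨h.nonsquare₁, h.nonsquare₃, h.nonsquare₂, d₁ / q, div_ne_zero h.ne_zero₁ hq, ?_⟩
  field_simp
  linear_combination -(d₁ : ℚ) * hr

theorem nonsquare_mul (h : BiquadraticTriple d₁ d₂ d₃) : ¬ IsSquare ((d₁ : ℚ) * d₂) := by
  obtain ⟨q, hq, hr⟩ := h.rel
  rintro ⟨c, hc⟩
  refine h.nonsquare₃ ⟨c / q, ?_⟩
  field_simp
  linear_combination hr + hc

end BiquadraticTriple

theorem TernaryIsotropic.of_rat {u v : ℤ} {x y z : ℚ} (hy : y ≠ 0)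
    (h : z ^ 2 = u * x ^ 2 + v * y ^ 2) : TernaryIsotropic u v (-1) := by
  refine ⟨x.num * y.den * z.den, y.num * x.den * z.den, z.num * x.den * y.den,
    Or.inr (Or.inl (by simp [hy])), ?_⟩
  have hx' : (x.num : ℚ) = x * x.den := (Rat.mul_den_eq_num x).symm
  have hy' : (y.num : ℚ) = y * y.den := (Rat.mul_den_eq_num y).symm
  have hz' : (z.num : ℚ) = z * z.den := (Rat.mul_den_eq_num z).symm
  have : ((u * (x.num * y.den * z.den) ^ 2 + v * (y.num * x.den * z.den) ^ 2 +
      -1 * (z.num * x.den * y.den) ^ 2 : ℤ) : ℚ) = 0 := by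
    push_cast
    rw [hx', hy', hz']
    linear_combination -(x.den * y.den * z.den : ℚ) ^ 2 * h
  exact_mod_cast this

/-- A zero with `y = 0` would exhibit `u` as the square of `z / x`. -/
theorem TernaryIsotropic.exists_rat {u v : ℤ} (hu : ¬ IsSquare (u : ℚ))
    (h : TernaryIsotropic u v (-1)) :
    ∃ x y z : ℚ, y ≠ 0 ∧ z ^ 2 = u * x ^ 2 + v * y ^ 2 := by
  obtain ⟨x, y, z, hne, h⟩ := h
  have hq : (z : ℚ) ^ 2 = u * x ^ 2 + v * y ^ 2 := by
    have := congrArg (Int.cast : ℤ → ℚ) h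
    push_cast at this
    linarith
  refine ⟨x, y, z, fun hy => ?_, hq⟩
  have hy0 : y = 0 := by exact_mod_cast hy
  subst hy0
  by_cases hx : x = 0
  · subst hx
    have : z = 0 := by
      have : (z : ℚ) ^ 2 = 0 := by rw [hq]; simp
      exact_mod_cast pow_eq_zero_iff two_ne_zero |>.mp this
    tauto
  · have hx' : (x : ℚ) ≠ 0 := by exact_mod_cast hx
    refine hu ⟨z / x, ?_⟩
    field_simp
    rw [hq]
    simp

/-- `d₁ x² + d₃ y² = z²` is solvable iff `d₁ x² - d₂ y² = z²` is. -/
theorem BiquadraticTriple.isotropic_third {d₁ d₂ d₃ : ℤ} (h : BiquadraticTriple d₁ d₂ d₃) :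
    TernaryIsotropic d₁ d₃ (-1) ↔ TernaryIsotropic d₁ (-d₂) (-1) := by
  obtain ⟨q, hq, hr⟩ := h.rel
  have h0 := h.ne_zero₁
  constructor
  · intro hi
    obtain ⟨x, y, z, hy, hxyz⟩ := hi.exists_rat h.nonsquare₁
    -- Dividing `z² = d₁ x² + d₃ y²` by `d₁` and using `d₃ = d₁ d₂ / q²` gives `x² = d₁ (z/d₁)² - d₂
    -- (y/q)²`.
    refine TernaryIsotropic.of_rat (x := z / d₁) (y := y / q) (z := x) (div_ne_zero hy hq) ?_
    push_cast
    field_simp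
    linear_combination -(q ^ 2) * hxyz - y ^ 2 * hr
  · intro hi
    obtain ⟨x, y, z, hy, hxyz⟩ := hi.exists_rat h.nonsquare₁
    push_cast at hxyz
    refine TernaryIsotropic.of_rat (x := z) (y := q * y) (z := d₁ * x) (mul_ne_zero hq hy) ?_
    linear_combination -(d₁ : ℚ) * hxyz - y ^ 2 * hr

/-- Multiplying the equation by `m` and absorbing `m²` into squares. With `m = k D₃` this removes
the common factor of `d₁` and `d₂`. -/
theorem isotropic_scale {a b m : ℤ} (hm : m ≠ 0) :
    TernaryIsotropic (m * a) (m * b) (-1) ↔ TernaryIsotropic a b (-m) := by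
  constructor
  · rintro ⟨x, y, z, hne, h⟩
    exact ⟨m * x, m * y, z, by simpa [hm] using hne, by linear_combination m * h⟩
  · rintro ⟨x, y, z, hne, h⟩
    exact ⟨x, y, m * z, by simpa [hm] using hne, by linear_combination m * h⟩

-- The square roots of `d₃` are `± a b / q`, so the third generator is redundant.
open IntermediateField in
theorem sqrtField_le_iff {d₁ d₂ d₃ : ℤ} (h : BiquadraticTriple d₁ d₂ d₃)
    {a b : AlgebraicClosure ℚ} (ha : a ^ 2 = d₁) (hb : b ^ 2 = d₂)
    (F : IntermediateField ℚ (AlgebraicClosure ℚ)) :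
    sqrtField d₁ d₂ d₃ ≤ F ↔ a ∈ F ∧ b ∈ F := by
  rw [sqrtField, adjoin_le_iff]
  constructor
  · intro hs
    exact ⟨hs (Or.inl ha), hs (Or.inr (Or.inl hb))⟩
  · rintro ⟨haF, hbF⟩ w hw
    have hmem : ∀ {u v : AlgebraicClosure ℚ}, v ∈ F → u ^ 2 = v ^ 2 → u ∈ F := fun hv huv => by
      rcases sq_eq_sq_iff_eq_or_eq_neg.mp huv with rfl | rfl
      · exact hv
      · exact neg_mem hv
    rcases hw with hw | hw | hw
    · exact hmem haF (hw.trans ha.symm)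
    · exact hmem hbF (hw.trans hb.symm)
    · obtain ⟨q, hq, hr⟩ := h.rel
      have hq' : (algebraMap ℚ (AlgebraicClosure ℚ) q) ≠ 0 := by simpa using hq
      refine hmem (div_mem (mul_mem haF hbF) (F.algebraMap_mem q)) ?_
      have := congrArg (algebraMap ℚ (AlgebraicClosure ℚ)) hr
      simp only [map_mul, map_pow, map_intCast] at this
      rw [hw, div_pow, mul_pow, ha, hb, ← this]
      field_simp

/-- A `D₄`-extension forces one of three conics to be solvable. -/
theorem isotropic_of_admitsExtension {d₁ d₂ d₃ : ℤ} (h : BiquadraticTriple d₁ d₂ d₃)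
    (hext : AdmitsExtension (DihedralGroup 4) (sqrtField d₁ d₂ d₃)) :
    TernaryIsotropic d₁ d₂ (-1) ∨ TernaryIsotropic d₁ d₃ (-1) ∨ TernaryIsotropic d₂ d₃ (-1) := by
  obtain ⟨F, hK, hfd, hgal, ⟨φ⟩⟩ := hext
  obtain ⟨a', ha'⟩ := IsAlgClosed.exists_pow_nat_eq (d₁ : AlgebraicClosure ℚ) two_pos
  obtain ⟨b', hb'⟩ := IsAlgClosed.exists_pow_nat_eq (d₂ : AlgebraicClosure ℚ) two_pos
  obtain ⟨haF, hbF⟩ := (sqrtField_le_iff h ha' hb' F).mp hK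
  obtain ⟨a, ha⟩ : ∃ a : F, a ^ 2 = algebraMap ℚ F d₁ :=
    ⟨⟨a', haF⟩, Subtype.ext (by simpa using ha')⟩
  obtain ⟨b, hb⟩ : ∃ b : F, b ^ 2 = algebraMap ℚ F d₂ :=
    ⟨⟨b', hbF⟩, Subtype.ext (by simpa using hb')⟩
  clear ha' hb' haF hbF
  obtain ⟨q, hq, hr⟩ := h.rel
  have hq' : algebraMap ℚ F q ≠ 0 := by simpa using hq
  obtain ⟨c, hc, hcab⟩ : ∃ c : F, c ^ 2 = algebraMap ℚ F d₃ ∧ c = a * b / algebraMap ℚ F q := by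
    refine ⟨_, ?_, rfl⟩
    rw [div_pow, mul_pow, ha, hb, ← map_mul, ← hr]
    simp only [map_mul, map_pow]
    field_simp
  have a0 := ne_zero_of_sq_eq_nonsquare ha h.nonsquare₁
  have b0 := ne_zero_of_sq_eq_nonsquare hb h.nonsquare₂
  have c0 := ne_zero_of_sq_eq_nonsquare hc h.nonsquare₃
  set r : F ≃ₐ[ℚ] F := φ.symm (.r 1) with hrdef
  set s : F ≃ₐ[ℚ] F := φ.symm (.sr 0) with hsdef
  have hfix : ∀ w : F, r w = w → s w = w → w ∈ Set.range (algebraMap ℚ F) := by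
    intro w hrw hsw
    rw [IsGalois.mem_range_algebraMap_iff_fixed]
    have hr' : r ∈ MulAction.stabilizer (F ≃ₐ[ℚ] F) w := hrw
    have hs' : s ∈ MulAction.stabilizer (F ≃ₐ[ℚ] F) w := hsw
    have hpow : ∀ i : ZMod 4, φ.symm (.r i) ∈ MulAction.stabilizer (F ≃ₐ[ℚ] F) w := fun i => by
      have : (DihedralGroup.r i : DihedralGroup 4) = (.r 1) ^ i.val := by
        rw [DihedralGroup.r_one_pow, ZMod.natCast_zmod_val]
      rw [this, map_pow]
      exact pow_mem hr' _
    intro g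
    suffices g ∈ MulAction.stabilizer (F ≃ₐ[ℚ] F) w from this
    rw [← φ.symm_apply_apply g]
    rcases φ g with i | i
    · exact hpow i
    · have : (DihedralGroup.sr i : DihedralGroup 4) = .sr 0 * .r i := by
        rw [DihedralGroup.sr_mul_r, zero_add]
      rw [this, map_mul]
      exact mul_mem hs' (hpow i)
  have tr : ∀ {x y : DihedralGroup 4}, x ≠ y → φ.symm x ≠ φ.symm y := fun h h' =>
    h (φ.symm.injective h')
  have h1 : r ^ 4 = 1 := by rw [hrdef, ← map_pow, ← map_one φ.symm]; congr 1
  have h2 : r ^ 2 ≠ 1 := by rw [hrdef, ← map_pow, ← map_one φ.symm]; exact tr (by decide)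
  have h3 : s * s = 1 := by rw [hsdef, ← map_mul, ← map_one φ.symm]; congr 1
  have h4 : s * r = r ^ 3 * s := by
    rw [hrdef, hsdef, ← map_pow, ← map_mul, ← map_mul]; congr 1
  have h5 : s ≠ 1 := by rw [hsdef, ← map_one φ.symm]; exact tr (by decide)
  have h6 : s ≠ r ^ 2 := by rw [hrdef, hsdef, ← map_pow]; exact tr (by decide)
  have conic : ∀ {u v : ℤ} {x y : F}, x ^ 2 = algebraMap ℚ F u → y ^ 2 = algebraMap ℚ F v →
      x ≠ 0 → y ≠ 0 → r x = -x → s x = x → r y = -y → s y = -y → TernaryIsotropic u v (-1) := by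
    intro u v x y hx hy hx0 hy0 hrx hsx hry hsy
    obtain ⟨x, y, z, hy, h⟩ := conic_of_dihedral h1 h2 h3 h4 h5 h6 hfix hx hy hx0 hy0 hrx hsx hry hsy
    exact TernaryIsotropic.of_rat hy h
  have nontriv : ∀ {u : ℤ} {x : F}, x ^ 2 = algebraMap ℚ F u → ¬ IsSquare (u : ℚ) →
      ¬ (r x = x ∧ s x = x) := by
    rintro u x hx hu ⟨hrx, hsx⟩
    obtain ⟨m, rfl⟩ := hfix x hrx hsx
    rw [← map_pow] at hx
    exact hu ⟨m, by rw [← sq]; exact ((algebraMap ℚ F).injective hx).symm⟩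
  have na := nontriv ha h.nonsquare₁
  have nb := nontriv hb h.nonsquare₂
  have nc := nontriv hc h.nonsquare₃
  have cr : r c = r a * r b / algebraMap ℚ F q := by simp [hcab]
  have cs : s c = s a * s b / algebraMap ℚ F q := by simp [hcab]
  have symm : ∀ {u v w : ℤ}, TernaryIsotropic u v w → TernaryIsotropic v u w := fun h => h.swap
  -- None of `a`, `b`, `c` is fixed by both `r` and `s`, and `c` is `ab` up to a rational factor, so
  -- their sign patterns are the three nontrivial ones. The two with patterns `(-, +)` and `(-, -)`
  -- give the conic.
  rcases algEquiv_apply_sqrt ha r with ra | ra <;> rcases algEquiv_apply_sqrt ha s with sa | sa <;>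
  rcases algEquiv_apply_sqrt hb r with rb | rb <;> rcases algEquiv_apply_sqrt hb s with sb | sb <;>
  rw [ra, rb] at cr <;> rw [sa, sb] at cs <;>
  simp only [neg_mul, mul_neg, neg_neg, neg_div, ← hcab] at cr cs <;>
  first
  | exact (na ⟨ra, sa⟩).elim
  | exact (nb ⟨rb, sb⟩).elim
  | exact (nc ⟨cr, cs⟩).elim
  | exact Or.inl (conic ha hb a0 b0 ra sa rb sb)
  | exact Or.inl (symm (conic hb ha b0 a0 rb sb ra sa))
  | exact Or.inr (Or.inl (conic ha hc a0 c0 ra sa cr cs))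
  | exact Or.inr (Or.inl (symm (conic hc ha c0 a0 cr cs ra sa)))
  | exact Or.inr (Or.inr (conic hb hc b0 c0 rb sb cr cs))
  | exact Or.inr (Or.inr (symm (conic hc hb c0 b0 cr cs rb sb)))

open Polynomial IntermediateField in
/-- A solvable conic produces a `D₄`-extension. -/
theorem admitsExtension_of_isotropic {d₁ d₂ d₃ : ℤ} (h : BiquadraticTriple d₁ d₂ d₃)
    (hi : TernaryIsotropic d₁ d₂ (-1)) :
    AdmitsExtension (DihedralGroup 4) (sqrtField d₁ d₂ d₃) := by
  obtain ⟨x, y, z, hy, hxyz⟩ := hi.exists_rat h.nonsquare₁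
  -- Needed to recover `a` from `t² = z + x a`.
  have hx : x ≠ 0 := by
    rintro rfl
    refine h.nonsquare₂ ⟨z / y, ?_⟩
    field_simp
    rw [hxyz]; ring
  obtain ⟨a, ha⟩ := IsAlgClosed.exists_pow_nat_eq (d₁ : AlgebraicClosure ℚ) two_pos
  obtain ⟨b, hb⟩ := IsAlgClosed.exists_pow_nat_eq (d₂ : AlgebraicClosure ℚ) two_pos
  set A := algebraMap ℚ (AlgebraicClosure ℚ) with hA
  obtain ⟨t, ht⟩ := IsAlgClosed.exists_pow_nat_eq (A z + A x * a) two_pos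
  have hnorm : (A z + A x * a) * (A z - A x * a) = (A y * b) ^ 2 := by
    have := congrArg A hxyz
    simp only [map_add, map_mul, map_pow, hA, map_intCast] at this
    linear_combination this - (A x) ^ 2 * ha - (A y) ^ 2 * hb
  have hx' : A x ≠ 0 := by simpa [hA] using hx
  have hy' : A y ≠ 0 := by simpa [hA] using hy
  have b0 : b ≠ 0 := by
    rintro rfl
    exact h.swap.ne_zero₁ (by
      have : (d₂ : AlgebraicClosure ℚ) = 0 := by rw [← hb]; simp
      exact_mod_cast this)
  have t0 : t ≠ 0 := by
    rintro rfl
    rw [← ht] at hnorm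
    exact pow_ne_zero 2 (mul_ne_zero hy' b0) (by rw [← hnorm]; ring)
  -- The roots of `p` are the square roots of `z ± x a`, namely `± t` and `± y b / t`.
  set p : ℚ[X] := (X ^ 2 - C z) ^ 2 - C (d₁ * x ^ 2) with hp
  have hpm : p.Monic := by
    rw [hp]
    monicity!
  have hroot : ∀ w : AlgebraicClosure ℚ, w ∈ p.rootSet (AlgebraicClosure ℚ) ↔
      w ^ 2 = A z + A x * a ∨ w ^ 2 = A z - A x * a := by
    intro w
    rw [mem_rootSet_of_ne hpm.ne_zero]
    have : aeval w p = (w ^ 2 - (A z + A x * a)) * (w ^ 2 - (A z - A x * a)) := by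
      simp only [hp, map_sub, map_pow, aeval_X, aeval_C, map_mul, map_intCast]
      rw [← ha]
      ring
    rw [this, mul_eq_zero, sub_eq_zero, sub_eq_zero]
  set F := adjoin ℚ (p.rootSet (AlgebraicClosure ℚ)) with hF
  have : p.IsSplittingField ℚ F := adjoin_rootSet_isSplittingField (IsAlgClosed.splits _)
  have hfd : FiniteDimensional ℚ F := IsSplittingField.finiteDimensional F p
  have hnor : Normal ℚ F := Normal.of_isSplittingField p
  have hgal : IsGalois ℚ F := { }
  have htF : t ∈ F := subset_adjoin _ _ ((hroot t).mpr (Or.inl ht))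
  have ht'F : A y * b / t ∈ F := by
    refine subset_adjoin _ _ ((hroot _).mpr (Or.inr ?_))
    rw [div_pow, ht, ← hnorm]
    have : A z + A x * a ≠ 0 := by rw [← ht]; exact pow_ne_zero 2 t0
    field_simp
  have hAF : ∀ c : ℚ, A c ∈ F := fun c => F.algebraMap_mem c
  have haF : a ∈ F := by
    have : a = (t ^ 2 - A z) / A x := by rw [ht]; field_simp; ring
    rw [this]
    exact div_mem (sub_mem (pow_mem htF 2) (hAF z)) (hAF x)
  have hbF : b ∈ F := by
    have : b = A y * b / t * t / A y := by field_simp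
    rw [this]
    exact div_mem (mul_mem ht'F htF) (hAF y)
  refine ⟨F, (sqrtField_le_iff h ha hb F).mpr ⟨haF, hbF⟩, hfd, hgal, ?_⟩
  refine nonempty_galois_mulEquiv_dihedralGroup (d₁ := d₁) (d₂ := d₂) (x := x) (y := y) (z := z)
    h.nonsquare₁ h.nonsquare₂ h.nonsquare_mul hxyz hy (a := ⟨a, haF⟩) (b := ⟨b, hbF⟩)
    (t := ⟨t, htF⟩) (Subtype.ext (by simpa using ha)) (Subtype.ext (by simpa using hb))
    (Subtype.ext (by simpa using ht)) ?_
  intro g g' hgt hgb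
  -- Every root is, up to sign, `t` or `y b / t`, so an automorphism is determined by its values at
  -- `t` and `b`.
  have hsub : (g : F →ₐ[ℚ] F) = g' := by
    refine IntermediateField.algHom_ext_of_eq_adjoin ℚ hF fun w hw => ?_
    have hw' := (hroot w).mp hw
    have hneg : ∀ {u v : F}, g u = g' u → v ^ 2 = u ^ 2 → g v = g' v := fun hu huv => by
      rcases sq_eq_sq_iff_eq_or_eq_neg.mp huv with rfl | rfl
      · exact hu
      · rw [map_neg, map_neg, hu]
    change g ⟨w, _⟩ = g' ⟨w, _⟩
    rcases hw' with hw' | hw'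
    · exact hneg hgt (Subtype.ext (by simpa using hw'.trans ht.symm))
    · refine hneg (u := algebraMap ℚ F y * ⟨b, hbF⟩ / ⟨t, htF⟩) (by simp [hgt, hgb])
        (Subtype.ext ?_)
      have : A z + A x * a ≠ 0 := by rw [← ht]; exact pow_ne_zero 2 t0
      have hgoal : w ^ 2 = (A y * b / t) ^ 2 := by
        rw [hw', div_pow, ht, ← hnorm]
        field_simp
      simpa using hgoal
  exact AlgEquiv.coe_toAlgHom_injective hsub

/-- The `D₄`-criterion: one of three conics is solvable. -/
theorem admitsExtension_iff {d₁ d₂ d₃ : ℤ} (h : BiquadraticTriple d₁ d₂ d₃) :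
    AdmitsExtension (DihedralGroup 4) (sqrtField d₁ d₂ d₃) ↔ TernaryIsotropic d₁ d₂ (-1) ∨
      TernaryIsotropic (-d₁) d₂ (-1) ∨ TernaryIsotropic d₁ (-d₂) (-1) := by
  have hsqrt : ∀ {a b c a' b' c' : ℤ},
      (∀ w : AlgebraicClosure ℚ, (w ^ 2 = a ∨ w ^ 2 = b ∨ w ^ 2 = c) ↔
        (w ^ 2 = a' ∨ w ^ 2 = b' ∨ w ^ 2 = c')) → sqrtField a b c = sqrtField a' b' c' := by
    intro a b c a' b' c' hw
    rw [sqrtField, sqrtField]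
    congr 1
    ext w
    exact hw w
  -- The pairs containing `d₃` become sign changes of `(d₁, d₂)`; this is the source of the three
  -- sign patterns in the weights.
  have e₁ : TernaryIsotropic d₁ d₃ (-1) ↔ TernaryIsotropic d₁ (-d₂) (-1) := h.isotropic_third
  have e₂ : TernaryIsotropic d₂ d₃ (-1) ↔ TernaryIsotropic (-d₁) d₂ (-1) :=
    h.swap.isotropic_third.trans ⟨fun h => h.swap, fun h => h.swap⟩
  constructor
  · intro hext
    rcases isotropic_of_admitsExtension h hext with hi | hi | hi
    · exact Or.inl hi
    · exact Or.inr (Or.inr (e₁.mp hi))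
    · exact Or.inr (Or.inl (e₂.mp hi))
  · rintro (hi | hi | hi)
    · exact admitsExtension_of_isotropic h hi
    · rw [hsqrt (a' := d₂) (b' := d₃) (c' := d₁) (fun w => by tauto)]
      exact admitsExtension_of_isotropic h.swap.swap₂₃ (e₂.mpr hi)
    · rw [hsqrt (a' := d₁) (b' := d₃) (c' := d₂) (fun w => by tauto)]
      exact admitsExtension_of_isotropic h.swap₂₃ (e₁.mpr hi)

theorem Squarefree.not_isSquare_ratCast {d : ℤ} (hd : Squarefree d) (h1 : d ≠ 1) :
    ¬ IsSquare (d : ℚ) := by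
  rw [Rat.isSquare_intCast_iff]
  rintro ⟨r, rfl⟩
  rcases Int.isUnit_iff.mp (hd r dvd_rfl) with rfl | rfl <;> simp at h1

/-! ### Admissible triples and the final formula -/

namespace AdmissibleTriple

variable {d₁ d₂ d₃ : ℤ}

theorem gcd_pos (h : AdmissibleTriple d₁ d₂ d₃) : 0 < Int.gcd d₁ d₂ :=
  Int.gcd_pos_of_ne_zero_left _ h.squarefree₁.ne_zero

theorem mul_gcd_sq (h : AdmissibleTriple d₁ d₂ d₃) :
    d₃ * (Int.gcd d₁ d₂ : ℤ) ^ 2 = d₁ * d₂ := by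
  rw [h.eq₃]
  refine Int.ediv_mul_cancel ?_
  rw [sq]
  exact mul_dvd_mul (Int.gcd_dvd_left ..) (Int.gcd_dvd_right ..)

theorem biquadraticTriple (h : AdmissibleTriple d₁ d₂ d₃) : BiquadraticTriple d₁ d₂ d₃ where
  nonsquare₁ := h.squarefree₁.not_isSquare_ratCast h.ne_one₁
  nonsquare₂ := h.squarefree₂.not_isSquare_ratCast h.ne_one₂
  nonsquare₃ := h.squarefree₃.not_isSquare_ratCast h.ne_one₃
  rel := ⟨(Int.gcd d₁ d₂ : ℤ), by exact_mod_cast h.gcd_pos.ne', by exact_mod_cast h.mul_gcd_sq⟩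

/-- The parametrization of an admissible triple whose gcd is `k D₃`. -/
theorem parametrization (h : AdmissibleTriple d₁ d₂ d₃) {k D₃ : ℕ}
    (hk : Int.gcd d₁ d₂ = k * D₃) :
    d₁ = d₁.sign * k * (d₁.natAbs / (k * D₃) : ℕ) * D₃ ∧
      d₂ = d₂.sign * k * (d₂.natAbs / (k * D₃) : ℕ) * D₃ ∧
      d₃ = d₁.sign * d₂.sign * (d₁.natAbs / (k * D₃) : ℕ) * (d₂.natAbs / (k * D₃) : ℕ) := by
  have a₁ : d₁.natAbs / (k * D₃) * (k * D₃) = d₁.natAbs :=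
    Nat.div_mul_cancel (hk ▸ Nat.gcd_dvd_left d₁.natAbs d₂.natAbs)
  have a₂ : d₂.natAbs / (k * D₃) * (k * D₃) = d₂.natAbs :=
    Nat.div_mul_cancel (hk ▸ Nat.gcd_dvd_right d₁.natAbs d₂.natAbs)
  have hg := h.mul_gcd_sq
  have hpos := h.gcd_pos
  rw [hk] at hg hpos
  generalize d₁.natAbs / (k * D₃) = D₁ at *
  generalize d₂.natAbs / (k * D₃) = D₂ at *
  have b₁ : d₁ = d₁.sign * k * D₁ * D₃ := by
    conv_lhs => rw [← Int.sign_mul_natAbs d₁, ← a₁]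
    push_cast
    ring
  have b₂ : d₂ = d₂.sign * k * D₂ * D₃ := by
    conv_lhs => rw [← Int.sign_mul_natAbs d₂, ← a₂]
    push_cast
    ring
  refine ⟨b₁, b₂, ?_⟩
  have h0 : ((k * D₃ : ℕ) : ℤ) ^ 2 ≠ 0 := by positivity
  refine mul_right_cancel₀ h0 ?_
  rw [hg]
  conv_lhs => rw [b₁, b₂]
  push_cast
  ring

theorem squarefree_mul (h : AdmissibleTriple d₁ d₂ d₃) {k D₃ : ℕ}
    (hk : Int.gcd d₁ d₂ = k * D₃) :
    Squarefree (d₁.natAbs / (k * D₃) * (d₂.natAbs / (k * D₃)) * D₃) := by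
  have a₁ : d₁.natAbs / (k * D₃) * (k * D₃) = d₁.natAbs :=
    Nat.div_mul_cancel (hk ▸ Nat.gcd_dvd_left d₁.natAbs d₂.natAbs)
  have a₂ : d₂.natAbs / (k * D₃) * (k * D₃) = d₂.natAbs :=
    Nat.div_mul_cancel (hk ▸ Nat.gcd_dvd_right d₁.natAbs d₂.natAbs)
  have hcop : (d₁.natAbs / (k * D₃)).Coprime (d₂.natAbs / (k * D₃)) := by
    rw [← hk]
    exact Nat.coprime_div_gcd_div_gcd h.gcd_pos
  have s₁ := Int.squarefree_natAbs.mpr h.squarefree₁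
  have s₂ := Int.squarefree_natAbs.mpr h.squarefree₂
  generalize d₁.natAbs / (k * D₃) = D₁ at *
  generalize d₂.natAbs / (k * D₃) = D₂ at *
  rw [← a₁] at s₁
  rw [← a₂] at s₂
  have t₁ : Squarefree (D₁ * D₃) := s₁.squarefree_of_dvd ⟨k, by ring⟩
  have t₂ : Squarefree (D₂ * D₃) := s₂.squarefree_of_dvd ⟨k, by ring⟩
  rw [Nat.squarefree_mul (Nat.Coprime.mul_left (Nat.coprime_of_squarefree_mul t₁)
    (Nat.coprime_of_squarefree_mul t₂)), Nat.squarefree_mul hcop]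
  exact ⟨⟨t₁.squarefree_of_dvd ⟨D₃, rfl⟩, t₂.squarefree_of_dvd ⟨D₃, rfl⟩⟩,
    t₁.squarefree_of_dvd ⟨D₁, by ring⟩⟩

-- Each of `d₁`, `d₂` is `k D₃` times its sign times `D₁`, respectively `D₂`, so scaling by `k D₃`
-- identifies the conics of `admitsExtension_iff` with those of `divisorSum_weight`.
open Classical in
theorem indicatorD4_eq (h : AdmissibleTriple d₁ d₂ d₃) {k D₃ : ℕ}
    (hk : Int.gcd d₁ d₂ = k * D₃)
    (hd : OddSquarefreeData k (d₁.natAbs / (k * D₃)) (d₂.natAbs / (k * D₃)) D₃) :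
    indicatorD4 d₁ d₂ d₃ = divisorSum (d₁.natAbs / (k * D₃)) (d₂.natAbs / (k * D₃)) D₃
      (DTuple.weight k d₁.sign d₂.sign) := by
  have hs : ∀ {d : ℤ}, Squarefree d → d.sign = 1 ∨ d.sign = -1 := fun {d} hd => by
    rcases lt_trichotomy 0 d with h | h | h
    · exact Or.inl (Int.sign_eq_one_of_pos h)
    · exact absurd h.symm hd.ne_zero
    · exact Or.inr (Int.sign_eq_neg_one_of_neg h)
  rw [divisorSum_weight hd (hs h.squarefree₁) (hs h.squarefree₂), indicatorD4]
  obtain ⟨b₁, b₂, -⟩ := h.parametrization hk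
  have hm : (k * D₃ : ℤ) ≠ 0 := by
    have := h.gcd_pos
    rw [hk] at this
    exact_mod_cast this.ne'
  have c₁ : d₁ = (k * D₃ : ℤ) * (d₁.sign * (d₁.natAbs / (k * D₃) : ℕ)) := by
    conv_lhs => rw [b₁]
    ring
  have c₂ : d₂ = (k * D₃ : ℤ) * (d₂.sign * (d₂.natAbs / (k * D₃) : ℕ)) := by
    conv_lhs => rw [b₂]
    ring
  refine if_congr ?_ rfl rfl
  rw [admitsExtension_iff h.biquadraticTriple, ← isotropic_scale hm, ← isotropic_scale hm,
    ← isotropic_scale hm]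
  simp only [neg_mul, mul_neg]
  rw [← c₁, ← c₂]

end AdmissibleTriple

theorem mainTheorem8 (d₁ d₂ d₃ : ℤ) (h : AdmissibleTriple d₁ d₂ d₃) :
    (¬ (2 ∣ d₁ * d₂) →
      let ε₁ : ℤ := d₁.sign
      let ε₂ : ℤ := d₂.sign
      let D₃ : ℕ := Int.gcd d₁ d₂
      let D₁ : ℕ := d₁.natAbs / D₃
      let D₂ : ℕ := d₂.natAbs / D₃
      d₁ = ε₁ * D₁ * D₃ ∧ d₂ = ε₂ * D₂ * D₃ ∧ d₃ = ε₁ * ε₂ * D₁ * D₂ ∧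
      Odd (D₁ * D₂ * D₃) ∧ Squarefree (D₁ * D₂ * D₃) ∧
      indicatorD4 d₁ d₂ d₃ = indicatorD4 (ε₁ * D₁ * D₃) (ε₂ * D₂ * D₃) (ε₁ * ε₂ * D₁ * D₂) ∧
      indicatorD4 d₁ d₂ d₃ = divisorSum D₁ D₂ D₃ (DTuple.FOdd ε₁ ε₂)) ∧
    (2 ∣ Int.gcd d₁ d₂ →
      let ε₁ : ℤ := d₁.sign
      let ε₂ : ℤ := d₂.sign
      let D₃ : ℕ := Int.gcd d₁ d₂ / 2
      let D₁ : ℕ := d₁.natAbs / (2 * D₃)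
      let D₂ : ℕ := d₂.natAbs / (2 * D₃)
      d₁ = ε₁ * 2 * D₁ * D₃ ∧ d₂ = ε₂ * 2 * D₂ * D₃ ∧ d₃ = ε₁ * ε₂ * D₁ * D₂ ∧
      Odd (D₁ * D₂ * D₃) ∧ Squarefree (D₁ * D₂ * D₃) ∧
      indicatorD4 d₁ d₂ d₃ =
        indicatorD4 (ε₁ * 2 * D₁ * D₃) (ε₂ * 2 * D₂ * D₃) (ε₁ * ε₂ * D₁ * D₂) ∧
      indicatorD4 d₁ d₂ d₃ = divisorSum D₁ D₂ D₃ (DTuple.FEven ε₁ ε₂)) := by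
  have heven : ∀ n : ℕ, Even n ↔ 2 ∣ n := fun n => even_iff_two_dvd
  constructor
  · intro hodd
    have hk : Int.gcd d₁ d₂ = 1 * Int.gcd d₁ d₂ := (one_mul _).symm
    have hp := h.parametrization hk
    have hsq := h.squarefree_mul hk
    have hind := h.indicatorD4_eq hk
    rw [one_mul, DTuple.weight_one] at hind
    rw [one_mul] at hp hsq
    simp only [Nat.cast_one, mul_one] at hp
    intro ε₁ ε₂ D₃ D₁ D₂
    obtain ⟨b₁, b₂, b₃⟩ : d₁ = ε₁ * D₁ * D₃ ∧ d₂ = ε₂ * D₂ * D₃ ∧ d₃ = ε₁ * ε₂ * D₁ * D₂ := hp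
    have ho : Odd (D₁ * D₂ * D₃) := by
      rw [← Nat.not_even_iff_odd, heven]
      intro h2
      refine hodd ?_
      have : ((2 : ℕ) : ℤ) ∣ ((D₁ * D₂ * D₃ : ℕ) : ℤ) := Int.natCast_dvd_natCast.mpr h2
      refine this.trans ⟨ε₁ * ε₂ * D₃, ?_⟩
      rw [b₁, b₂]
      push_cast
      ring
    refine ⟨b₁, b₂, b₃, ho, hsq, ?_, hind ⟨Or.inl rfl, ho, hsq⟩⟩
    rw [← b₁, ← b₂, ← b₃]
  · intro h2
    have hk : Int.gcd d₁ d₂ = 2 * (Int.gcd d₁ d₂ / 2) := (Nat.mul_div_cancel' h2).symm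
    have hp := h.parametrization hk
    have hsq := h.squarefree_mul hk
    have hind := h.indicatorD4_eq hk
    rw [DTuple.weight_two] at hind
    simp only [Nat.cast_ofNat] at hp
    intro ε₁ ε₂ D₃ D₁ D₂
    obtain ⟨b₁, b₂, b₃⟩ :
      d₁ = ε₁ * 2 * D₁ * D₃ ∧ d₂ = ε₂ * 2 * D₂ * D₃ ∧ d₃ = ε₁ * ε₂ * D₁ * D₂ := hp
    -- The factor `2` is already split off, and a squarefree `d` is not divisible by `4`.
    have hodd : ∀ {d e : ℤ} {D : ℕ}, Squarefree d → d = e * 2 * D * D₃ → Odd (D * D₃) := by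
      intro d e D hd hde
      rw [← Nat.not_even_iff_odd, heven]
      intro h2
      have h2' : ((2 : ℕ) : ℤ) ∣ ((D * D₃ : ℕ) : ℤ) := Int.natCast_dvd_natCast.mpr h2
      have h4 : (2 : ℤ) * 2 ∣ d := by
        obtain ⟨c, hc⟩ := h2'
        push_cast at hc
        exact ⟨e * c, by rw [hde]; linear_combination 2 * e * hc⟩
      exact Int.prime_two.not_isUnit (hd 2 h4)
    have o₁ := hodd h.squarefree₁ b₁
    have o₂ := hodd h.squarefree₂ b₂
    have ho : Odd (D₁ * D₂ * D₃) := by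
      rw [mul_assoc]
      exact (Nat.odd_mul.mp o₁).1.mul o₂
    refine ⟨b₁, b₂, b₃, ho, hsq, ?_, hind ⟨Or.inr rfl, ho, hsq⟩⟩
    rw [← b₁, ← b₂, ← b₃]
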